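/- Let $A$ be an artin algebra, i.e. an algebra over a commutative artinian ring $R$ that is finitely generated as an $R$-module, and let $A\text{-mod}$ be the category of finitely generated left $A$-modules. Let $S$ be a \emph{localizable} simple $A$-module, that is, a simple $A$-module with $\operatorname{proj.dim}_A S\le 1$ and $\operatorname{Ext}^1_A(S,S)=0$. Let $$S^{\perp}=\{X\in A\text{-mod}\mid \operatorname{Hom}_A(S,X)=0=\operatorname{Ext}^1_A(S,X)\},$$ let $i\colon S^\perp\to A\text{-mod}$ be the inclusion, $i_\lambda\colon A\text{-mod}\to S^\perp$ its left adjoint (which exists), $\eta\colon \mathrm{Id}\to L=i\,i_\lambda$ the unit of the adjunction, and $\eta_A\colon A\to L(A)$ its value at the regular module $A$. For $Y\in S^\perp$ and $y\in Y$, let $\hat r_y\colon L(A)\to Y$ be the unique $A$-linear map with $\hat r_y(\eta_A(a))=a.y$ for all $a\in A$. Then $L(A)$ is a ring with multiplication $x\star y=\hat r_y(x)$, the map $\eta_A\colon A\to L(A)$ is a ring homomorphism (the \emph{left retraction} associated to $S$), and each $Y\in S^\perp$ is an $L(A)$-module via $x.y=\hat r_y(x)$; in this way $S^\perp$ is identified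 with $L(A)\text{-mod}$. Call an artin algebra $B$ \emph{Gorenstein} if the regular module $B$ has finite injective dimension both as a left and as a right $B$-module. Let $I$ be the injective envelope of $S$ in $A\text{-mod}$. Then $A$ is Gorenstein if and only if $L(A)$ is Gorenstein and $\operatorname{proj.dim}_{L(A)} i_\lambda(I)<\infty$. -/

import Mathlib

open CategoryTheory Abelian

universe u

/-- `A` is an artin algebra: an algebra over some commutative artinian ring `R`, finitely generated
as an `R`-module. (Replacing `R` by its image in `A`, one may take `R` in the universe of `A`.) -/
class IsArtinAlgebra (A : Type u) [Ring A] : Prop where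
  exists_base : ∃ (R : Type u) (_ : CommRing R) (_ : Algebra R A),
    IsArtinianRing R ∧ Module.Finite R A

/-- A simple `A`-module `S` is localizable if `proj.dim S ≤ 1` and `Ext¹(S, S) = 0`. -/
class IsLocalizable (A : Type u) [Ring A] (S : Type u) [AddCommGroup S] [Module A S] : Prop where
  isSimple : IsSimpleModule A S
  projectiveDimension_le_one : projectiveDimension (ModuleCat.of A S) ≤ 1
  subsingleton_ext_one : Subsingleton (Ext (ModuleCat.of A S) (ModuleCat.of A S) 1)

/-- An artin algebra `A` is Gorenstein if the regular module has finite injective dimension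
on both sides (right modules are modules over `Aᵐᵒᵖ`). -/
def IsGorenstein (A : Type u) [Ring A] : Prop :=
  injectiveDimension (ModuleCat.of.{u} A A) < ⊤ ∧
    injectiveDimension (ModuleCat.of.{u} Aᵐᵒᵖ A) < ⊤

/-- `ι : M → I` is an injective envelope: `I` is injective and `ι` is an essential embedding. -/
structure IsInjectiveEnvelope {A : Type u} [Ring A] {M I : Type u} [AddCommGroup M] [Module A M]
    [AddCommGroup I] [Module A I] (ι : M →ₗ[A] I) : Prop where
  moduleInjective : Module.Injective A I
  injective : Function.Injective ι
  essential : ∀ N : Submodule A I, N ⊓ LinearMap.range ι = ⊥ → N = ⊥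

/-- The objects `X` of the category of finitely generated `A`-modules with
`Hom(S, X) = 0 = Ext¹(S, X)`. -/
def perp (A : Type u) [Ring A] (S : Type u) [AddCommGroup S] [Module A S] :
    ObjectProperty (FGModuleCat.{u} A) := fun X =>
  Subsingleton (S →ₗ[A] X) ∧ Subsingleton (Ext (ModuleCat.of A S) X.obj 1)

/-- The perpendicular subcategory `S^⊥` of the category of finitely generated `A`-modules. -/
abbrev PerpCat (A : Type u) [Ring A] (S : Type u) [AddCommGroup S] [Module A S] :=
  (perp A S).FullSubcategory

/-- The inclusion functor `i : S^⊥ ⥤ A-mod`. -/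
abbrev perpInclusion (A : Type u) [Ring A] (S : Type u) [AddCommGroup S] [Module A S] :
    PerpCat A S ⥤ FGModuleCat.{u} A :=
  (perp A S).ι

/-! The inclusion `i` has a left adjoint, by the construction of the universal map to `S^⊥`. -/

section Reflection

variable {A : Type u} [Ring A]

/-- Every homomorphism from the left ideal `K` to `X` extends to `A`. -/
def ExtendsFrom (K : Submodule A A) (X : Type u) [AddCommGroup X] [Module A X] : Prop :=
  ∀ g : K →ₗ[A] X, ∃ h : A →ₗ[A] X, ∀ k : K, h k = g k

/-- Vanishing of `Ext¹(S, X)` in terms of a presentation `p : A → S`. -/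
lemma extendsFrom_ker_iff {S : Type u} [AddCommGroup S] [Module A S] {p : A →ₗ[A] S}
    (hp : Function.Surjective p) (X : Type u) [AddCommGroup X] [Module A X] :
    ExtendsFrom (LinearMap.ker p) X ↔
      Subsingleton (Ext (ModuleCat.of A S) (ModuleCat.of A X) 1) := by
  have hS := LinearMap.shortExact_shortComplexKer hp
  have hz (y : Ext (ModuleCat.of A A) (ModuleCat.of A X) 1) : y = 0 :=
    have : Projective (ModuleCat.of A A) :=
      (IsProjective.iff_projective (R := A) A).1 inferInstance
    Ext.eq_zero_of_projective (P := ModuleCat.of A A) y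
  constructor
  · intro h
    refine subsingleton_of_forall_eq 0 fun x => ?_
    obtain ⟨x₁, rfl⟩ := Ext.contravariant_sequence_exact₃ hS (ModuleCat.of A X) x (hz _)
      (n₀ := 0) rfl
    obtain ⟨g, rfl⟩ := Ext.homEquiv₀.symm.surjective x₁
    obtain ⟨e, he⟩ := h g.hom
    have : g = (LinearMap.shortComplexKer p).f ≫ ModuleCat.ofHom e := by
      ext k
      exact (he k).symm
    rw [this, Ext.homEquiv₀_symm_apply, ← Ext.mk₀_comp_mk₀, hS.extClass_comp_assoc]
  · intro h g
    obtain ⟨x₂, hx⟩ := Ext.contravariant_sequence_exact₁ hS (ModuleCat.of A X)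
      (Ext.mk₀ (ModuleCat.ofHom g)) (n₁ := 1) rfl (h.elim _ _)
    obtain ⟨e, rfl⟩ := Ext.homEquiv₀.symm.surjective x₂
    rw [Ext.homEquiv₀_symm_apply, Ext.mk₀_comp_mk₀] at hx
    have := Ext.homEquiv₀.symm.injective hx
    refine ⟨e.hom, fun k => ?_⟩
    exact LinearMap.congr_fun (congrArg ModuleCat.Hom.hom this) k

lemma projective_ker {S : Type u} [AddCommGroup S] [Module A S] {p : A →ₗ[A] S}
    (hp : Function.Surjective p) (h : HasProjectiveDimensionLE (ModuleCat.of A S) 1) :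
    Module.Projective A (LinearMap.ker p) := by
  have hS := LinearMap.shortExact_shortComplexKer hp
  have h2 : Projective (ModuleCat.of A A) :=
      (IsProjective.iff_projective (R := A) A).1 inferInstance
  have := (hS.hasProjectiveDimensionLT_X₃_iff 0 h2).1 h
  exact (IsProjective.iff_projective (R := A) (LinearMap.ker p)).2
    (projective_iff_hasProjectiveDimensionLT_one.2 this)

lemma ExtendsFrom.pi {K : Submodule A A} {X : Type u} [AddCommGroup X] [Module A X]
    (h : ExtendsFrom K X) (ι : Type) : ExtendsFrom K (ι → X) := by
  intro g
  choose e he using fun i => h (LinearMap.proj i ∘ₗ g)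
  exact ⟨LinearMap.pi e, fun k => funext fun i => he i k⟩

lemma ExtendsFrom.congr {K : Submodule A A} {X Y : Type u} [AddCommGroup X] [Module A X]
    [AddCommGroup Y] [Module A Y] (h : ExtendsFrom K X) (e : X ≃ₗ[A] Y) : ExtendsFrom K Y := by
  intro g
  obtain ⟨f, hf⟩ := h (e.symm.toLinearMap ∘ₗ g)
  exact ⟨e.toLinearMap ∘ₗ f, fun k => by simp [hf]⟩

/-- Over an artin algebra, homomorphisms between finitely generated modules are, up to the action
of central elements, generated by finitely many. -/
lemma exists_hom_generators (R : Type u) [CommRing R] [Algebra R A] [IsArtinianRing R]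
    [Module.Finite R A] (K X : Type u) [AddCommGroup K] [Module A K] [Module.Finite A K]
    [AddCommGroup X] [Module A X] [Module.Finite A X] :
    ∃ (m : ℕ) (f : Fin m → (K →ₗ[A] X)), ∀ g : K →ₗ[A] X,
      ∃ r : Fin m → R, ∀ k, g k = ∑ i, f i (algebraMap R A (r i) • k) := by
  let : Module R X := Module.compHom X (algebraMap R A)
  have : IsScalarTower R A X := ⟨fun r a x => by
    change (r • a) • x = algebraMap R A r • (a • x)
    rw [Algebra.smul_def, mul_smul]⟩
  have : SMulCommClass A R X := ⟨fun a r x => by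
    change a • (algebraMap R A r • x) = algebraMap R A r • (a • x)
    rw [← mul_smul, ← mul_smul, Algebra.commutes]⟩
  have : Module.Finite R X := Module.Finite.trans A X
  obtain ⟨n, s, hs⟩ := Module.Finite.exists_fin (R := A) (M := K)
  let ev : (K →ₗ[A] X) →ₗ[R] (Fin n → X) :=
    { toFun := fun g i => g (s i)
      map_add' := fun _ _ => rfl
      map_smul' := fun _ _ => rfl }
  have hev : Function.Injective ev := by
    intro g g' h
    refine LinearMap.ext_on_range hs fun i => congrFun h i
  have : IsNoetherian R (K →ₗ[A] X) := isNoetherian_of_injective ev hev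
  obtain ⟨m, f, hf⟩ := Module.Finite.exists_fin (R := R) (M := K →ₗ[A] X)
  refine ⟨m, f, fun g => ?_⟩
  obtain ⟨r, hr⟩ := (Submodule.mem_span_range_iff_exists_fun R).1 (hf ▸ Submodule.mem_top (x := g))
  refine ⟨r, fun k => ?_⟩
  rw [← hr, LinearMap.sum_apply]
  refine Finset.sum_congr rfl fun i _ => ?_
  rw [map_smul]
  rfl

/-- Existence of the universal map from a finitely generated module to one that is right
perpendicular to `S`. -/
lemma exists_reflection (R : Type u) [CommRing R] [Algebra R A] [IsArtinianRing R]
    [Module.Finite R A] {S : Type u} [AddCommGroup S] [Module A S] [IsSimpleModule A S]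
    {p : A →ₗ[A] S} (hp : Function.Surjective p) [Module.Projective A (LinearMap.ker p)]
    (hS : ExtendsFrom (LinearMap.ker p) S)
    (X : Type u) [AddCommGroup X] [Module A X] [Module.Finite A X] :
    ∃ (Y : Type u) (_ : AddCommGroup Y) (_ : Module A Y) (_ : Module.Finite A Y)
      (η : X →ₗ[A] Y), (∀ f : S →ₗ[A] Y, f = 0) ∧ ExtendsFrom (LinearMap.ker p) Y ∧
      ∀ (Z : Type u) [AddCommGroup Z] [Module A Z], (∀ f : S →ₗ[A] Z, f = 0) →
        ExtendsFrom (LinearMap.ker p) Z → ∀ f : X →ₗ[A] Z, ∃! g : Y →ₗ[A] Z, g ∘ₗ η = f := by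
  have : IsNoetherian R A := inferInstance
  have : IsNoetherianRing A := isNoetherian_of_tower R inferInstance
  obtain ⟨m, f, hf⟩ := exists_hom_generators (A := A) R (LinearMap.ker p) X
  -- `X'` is the extension of `S ^ m` by `X` with classes given by the `f i`
  let φ : (Fin m → LinearMap.ker p) →ₗ[A] X × (Fin m → A) :=
    (-(∑ i, f i ∘ₗ LinearMap.proj i)).prod
      (LinearMap.pi fun i => (LinearMap.ker p).subtype ∘ₗ LinearMap.proj i)
  let N := LinearMap.range φ
  let X' := (X × (Fin m → A)) ⧸ N
  let j : X →ₗ[A] X' := N.mkQ ∘ₗ LinearMap.inl A _ _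
  let c : (Fin m → A) →ₗ[A] X' := N.mkQ ∘ₗ LinearMap.inr A _ _
  have hjc (k : Fin m → LinearMap.ker p) : c (fun i => k i) = j (∑ i, f i (k i)) := by
    refine (Submodule.Quotient.eq N).2 ⟨k, ?_⟩
    refine Prod.ext ?_ (funext fun i => ?_) <;> simp [φ, -map_sum]
  -- homomorphisms from `K` to `X` extend after composition with `j`
  have hext1 (g : LinearMap.ker p →ₗ[A] X) : ∃ h : A →ₗ[A] X', ∀ k : LinearMap.ker p,
      h k = j (g k) := by
    obtain ⟨r, hr⟩ := hf g
    let q : A →ₗ[A] (Fin m → A) :=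
      LinearMap.pi fun i => LinearMap.toSpanSingleton A A (algebraMap R A (r i))
    refine ⟨c ∘ₗ q, fun k => ?_⟩
    rw [hr k, ← hjc fun i => algebraMap R A (r i) • k, LinearMap.comp_apply]
    congr 1
    funext i
    simp [q, Algebra.smul_def, Algebra.commutes]
  have hext : ExtendsFrom (LinearMap.ker p) X' := by
    intro g
    obtain ⟨g', hg'⟩ := Module.projective_lifting_property N.mkQ g N.mkQ_surjective
    obtain ⟨u, hu⟩ := hS.pi (Fin m)
      ((LinearMap.pi fun i => p ∘ₗ LinearMap.proj i) ∘ₗ LinearMap.snd A X (Fin m → A) ∘ₗ g')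
    choose a ha using fun i => hp (u 1 i)
    let v : A →ₗ[A] (Fin m → A) := LinearMap.toSpanSingleton A _ a
    have hv (b : A) (i : Fin m) : p (v b i) = u b i := by
      have : u b = b • u 1 := by rw [← map_smul]; simp
      simp only [v, LinearMap.toSpanSingleton_apply, Pi.smul_apply, map_smul, ha, this]
    let w : LinearMap.ker p →ₗ[A] (Fin m → LinearMap.ker p) := LinearMap.pi fun i =>
      LinearMap.codRestrict (LinearMap.ker p) (LinearMap.proj i ∘ₗ
        (LinearMap.snd A X (Fin m → A) ∘ₗ g' - v ∘ₗ (LinearMap.ker p).subtype)) (fun k => by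
          have h1 := congrFun (hu k) i
          have h2 := hv k i
          simp only [LinearMap.comp_apply, LinearMap.pi_apply, LinearMap.proj_apply] at h1
          simp [h2, h1])
    obtain ⟨h, hh⟩ := hext1 (LinearMap.fst A X (Fin m → A) ∘ₗ g' +
      (∑ i, f i ∘ₗ LinearMap.proj i) ∘ₗ w)
    refine ⟨h + c ∘ₗ v, fun k => ?_⟩
    have e1 : g k = N.mkQ (g' k) := (LinearMap.congr_fun hg' k).symm
    have e2 : g' k = LinearMap.inl A X (Fin m → A) (g' k).1 +
        (LinearMap.inr A X (Fin m → A) (fun i => (w k i : A)) +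
          LinearMap.inr A X (Fin m → A) (v k)) := by
      refine Prod.ext (by simp) (funext fun i => ?_)
      change (g' k).2 i = 0 + (((g' k).2 i - v k i) + v k i)
      simp
    rw [e1, e2, map_add, map_add]
    change h k + c (v k) = j (g' k).1 + (c (fun i => (w k i : A)) + c (v k))
    rw [hjc, hh, ← add_assoc, ← map_add]
    congr 2
    simp
  -- `Y` is the quotient of `X'` by its `S`-isotypic component
  let T := isotypicComponent A X' S
  have hT : ExtendsFrom (LinearMap.ker p) T := by
    obtain ⟨n, ⟨e⟩⟩ := (IsIsotypicOfType.isotypicComponent A X' S).linearEquiv_fun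
    exact (hS.pi (Fin n)).congr e.symm
  have hST (g : S →ₗ[A] X') (s : S) : g s ∈ T := by
    rcases g.injective_or_eq_zero with hg | rfl
    · exact (le_sSup ⟨(LinearEquiv.ofInjective g hg).symm⟩ :
        LinearMap.range g ≤ isotypicComponent A X' S) ⟨s, rfl⟩
    · simp
  have hdesc {Z : Type u} [AddCommGroup Z] [Module A Z] (d : A →ₗ[A] Z)
      (hd : ∀ k : LinearMap.ker p, d k = 0) : ∃ d' : S →ₗ[A] Z, ∀ a, d' (p a) = d a := by
    refine ⟨(LinearMap.ker p).liftQ d (fun k hk => hd ⟨k, hk⟩) ∘ₗ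
      (p.quotKerEquivOfSurjective hp).symm.toLinearMap, fun a => ?_⟩
    have : (p.quotKerEquivOfSurjective hp).symm (p a) = Submodule.Quotient.mk a := by
      rw [LinearEquiv.symm_apply_eq]; rfl
    rw [LinearMap.comp_apply, LinearEquiv.coe_coe, this]
    rfl
  refine ⟨X' ⧸ T, inferInstance, inferInstance, inferInstance, T.mkQ ∘ₗ j, ?_, ?_, ?_⟩
  · intro g
    obtain ⟨h, hh⟩ := Module.projective_lifting_property T.mkQ (g ∘ₗ p) T.mkQ_surjective
    have hh' (a : A) : T.mkQ (h a) = g (p a) := LinearMap.congr_fun hh a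
    obtain ⟨w, hw⟩ := hT (LinearMap.codRestrict T (h ∘ₗ (LinearMap.ker p).subtype) (fun k => by
      rw [← Submodule.Quotient.mk_eq_zero]
      have := hh' k
      rw [LinearMap.mem_ker.1 k.2, map_zero] at this
      exact this))
    obtain ⟨d, hd⟩ := hdesc (h - T.subtype ∘ₗ w) (fun k => by simp [hw])
    ext s
    obtain ⟨a, rfl⟩ := hp s
    rw [← hh', LinearMap.zero_apply]
    refine (Submodule.Quotient.mk_eq_zero T).2 ?_
    have h1 := hST d (p a)
    rw [hd] at h1
    have := T.add_mem h1 (w a).2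
    simpa using this
  · intro g
    obtain ⟨g', hg'⟩ := Module.projective_lifting_property T.mkQ g T.mkQ_surjective
    obtain ⟨h, hh⟩ := hext g'
    exact ⟨T.mkQ ∘ₗ h, fun k => by
      rw [LinearMap.comp_apply, hh, ← LinearMap.comp_apply, hg']⟩
  · intro Z _ _ hZ0 hZ1 g
    choose e he using fun i => hZ1 (g ∘ₗ f i)
    let g1 : X' →ₗ[A] Z := N.liftQ (g.coprod (∑ i, e i ∘ₗ LinearMap.proj i)) (by
      rintro _ ⟨k, rfl⟩
      simp [φ, he])
    let g2 : (X' ⧸ T) →ₗ[A] Z := T.liftQ g1 (sSup_le fun M ⟨eM⟩ x hx => by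
      have := LinearMap.congr_fun (hZ0 (g1 ∘ₗ M.subtype ∘ₗ eM.symm.toLinearMap)) (eM ⟨x, hx⟩)
      simpa using this)
    refine ⟨g2, ?_, fun g3 hg3 => ?_⟩
    · ext x
      change g x + _ = g x
      simp
    · have key : ∀ d : X' →ₗ[A] Z, d ∘ₗ j = 0 → d = 0 := by
        intro d hd
        refine Submodule.linearMap_qext _ (LinearMap.prod_ext hd ?_)
        refine LinearMap.pi_ext' fun i => ?_
        obtain ⟨d', hd'⟩ := hdesc (d ∘ₗ c ∘ₗ LinearMap.single A (fun _ => A) i) (fun k => by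
          have h1 := hjc (Pi.single i k)
          have h2 : (fun i' => ((Pi.single i k : Fin m → LinearMap.ker p) i' : A)) =
              Pi.single i (k : A) := by
            funext i'
            by_cases h : i' = i
            · subst h; simp
            · simp [h]
          rw [h2] at h1
          rw [LinearMap.comp_apply, LinearMap.comp_apply, LinearMap.coe_single, h1]
          exact LinearMap.congr_fun hd _)
        rw [hZ0 d'] at hd'
        ext
        exact (hd' 1).symm
      refine Submodule.linearMap_qext _ (sub_eq_zero.1 (key _ ?_))
      ext x
      have h3 := LinearMap.congr_fun hg3 x
      have h4 : g2 (T.mkQ (j x)) = g x := by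
        change g x + _ = g x
        simp
      simp only [LinearMap.comp_apply, LinearMap.sub_apply, LinearMap.zero_apply] at h3 ⊢
      rw [h3, h4, sub_self]

end Reflection

section Retraction

variable (A : Type u) [Ring A] [IsArtinAlgebra A]
  (S : Type u) [AddCommGroup S] [Module A S] [IsLocalizable A S]

lemma exists_perp_reflection (X : FGModuleCat.{u} A) :
    ∃ (Y : PerpCat A S) (η : X ⟶ (perpInclusion A S).obj Y), ∀ Z : PerpCat A S,
      Function.Bijective fun g : Y ⟶ Z => η ≫ (perpInclusion A S).map g := by
  obtain ⟨R, _, _, _, _⟩ := IsArtinAlgebra.exists_base (A := A)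
  have := IsLocalizable.isSimple (A := A) (S := S)
  have hpd : HasProjectiveDimensionLE (ModuleCat.of A S) 1 :=
    (projectiveDimension_le_iff _ 1).1 (IsLocalizable.projectiveDimension_le_one (A := A) (S := S))
  have := IsSimpleModule.nontrivial A S
  obtain ⟨s, hs⟩ := exists_ne (0 : S)
  have hp : Function.Surjective (LinearMap.toSpanSingleton A S s) :=
    IsSimpleModule.toSpanSingleton_surjective A hs
  have := projective_ker hp hpd
  obtain ⟨Y, _, _, _, η, h0, h1, hu⟩ := exists_reflection R hp
    ((extendsFrom_ker_iff hp S).2 IsLocalizable.subsingleton_ext_one) X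
  refine ⟨⟨FGModuleCat.of A Y, subsingleton_of_forall_eq 0 h0, (extendsFrom_ker_iff hp Y).1 h1⟩,
    ConcreteCategory.ofHom η, fun Z => ?_⟩
  have key := hu Z.obj (fun f => Z.property.1.elim f 0) ((extendsFrom_ker_iff hp Z.obj).2 Z.property.2)
  constructor
  · intro g g' h
    have h' := congrArg (fun f => f.hom.hom) h
    exact ObjectProperty.hom_ext _ (FGModuleCat.hom_ext ((key _).unique h' rfl))
  · intro f
    obtain ⟨g, hg, -⟩ := key f.hom.hom
    exact ⟨ObjectProperty.homMk (FGModuleCat.ofHom g), FGModuleCat.hom_ext hg⟩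

instance : (perpInclusion A S).IsRightAdjoint := by
  choose Y η h using exists_perp_reflection A S
  exact (Adjunction.adjunctionOfEquivLeft (F_obj := Y) (G := perpInclusion A S)
    (fun X Z => Equiv.ofBijective _ (h X Z)) (fun X Z Z' g f => by simp)).isRightAdjoint

/-- The left retraction of categories `i_λ : A-mod ⥤ S^⊥`, the left adjoint of the inclusion. -/
noncomputable def iLambda : FGModuleCat.{u} A ⥤ PerpCat A S :=
  (perpInclusion A S).leftAdjoint

/-- The adjoint pair `(i_λ, i)`. -/
noncomputable def perpAdj : iLambda A S ⊣ perpInclusion A S :=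
  Adjunction.ofIsRightAdjoint (perpInclusion A S)

/-- The localization functor `L = i i_λ`. -/
noncomputable abbrev perpL : FGModuleCat.{u} A ⥤ FGModuleCat.{u} A :=
  iLambda A S ⋙ perpInclusion A S

/-- The unit `η : Id ⟶ L` of the adjoint pair `(i_λ, i)`. -/
noncomputable abbrev perpUnit : 𝟭 (FGModuleCat.{u} A) ⟶ perpL A S :=
  (perpAdj A S).unit

/-- The underlying type of the algebra `L(A)`. -/
def RetractionAlgebra : Type u := (perpL A S).obj (FGModuleCat.of A A)

noncomputable instance : AddCommGroup (RetractionAlgebra A S) :=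
  inferInstanceAs (AddCommGroup ((perpL A S).obj (FGModuleCat.of A A)))

noncomputable instance : Module A (RetractionAlgebra A S) :=
  inferInstanceAs (Module A ((perpL A S).obj (FGModuleCat.of A A)))

/-- `η_A : A → L(A)` as an `A`-linear map. -/
noncomputable def etaLinear : A →ₗ[A] RetractionAlgebra A S :=
  ((perpUnit A S).app (FGModuleCat.of A A)).hom.hom

/-- For an element `y` of an `A`-module `Y`, the morphism `r_y : A → Y`, `a ↦ a • y`. -/
def rightMul (Y : FGModuleCat.{u} A) (y : Y) : FGModuleCat.of A A ⟶ Y :=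
  ConcreteCategory.ofHom (LinearMap.toSpanSingleton A Y y)

variable {A S}

/-- For `y` in an object `Y` of `S^⊥`, the unique extension `L(A) → Y` along `η_A` of the
morphism `r_y : A → Y`, `a ↦ a • y`. -/
noncomputable def extendRightMul (Y : PerpCat A S) (y : Y.obj) :
    RetractionAlgebra A S →ₗ[A] Y.obj :=
  (((perpAdj A S).homEquiv (FGModuleCat.of A A) Y).symm (rightMul A Y.obj y)).hom.hom.hom

lemma extendRightMul_eta (Y : PerpCat A S) (y : Y.obj) (a : A) :
    extendRightMul Y y (etaLinear A S a) = a • y := by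
  have h := ((perpAdj A S).homEquiv (FGModuleCat.of A A) Y).apply_symm_apply (rightMul A Y.obj y)
  rw [Adjunction.homEquiv_unit] at h
  exact LinearMap.congr_fun (congrArg (fun f => f.hom.hom) h) a

lemma retraction_hom_ext {Y : PerpCat A S} {f g : RetractionAlgebra A S →ₗ[A] Y.obj}
    (h : ∀ a, f (etaLinear A S a) = g (etaLinear A S a)) : f = g := by
  let f' : (iLambda A S).obj (FGModuleCat.of A A) ⟶ Y :=
    ObjectProperty.homMk (ObjectProperty.homMk (ModuleCat.ofHom f))
  let g' : (iLambda A S).obj (FGModuleCat.of A A) ⟶ Y :=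
    ObjectProperty.homMk (ObjectProperty.homMk (ModuleCat.ofHom g))
  have : f' = g' := by
    apply ((perpAdj A S).homEquiv (FGModuleCat.of A A) Y).injective
    rw [Adjunction.homEquiv_unit, Adjunction.homEquiv_unit]
    exact FGModuleCat.hom_ext (LinearMap.ext h)
  exact congrArg (fun f => f.hom.hom.hom) this

/-- The object `i_λ(A)` of `S^⊥`; its underlying `A`-module is `L(A)`. -/
noncomputable abbrev perpA (A S : Type u) [Ring A] [IsArtinAlgebra A] [AddCommGroup S] [Module A S]
    [IsLocalizable A S] : PerpCat A S := (iLambda A S).obj (FGModuleCat.of A A)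

/-- The unique extension `L(A) → L(A)` of `r_y : A → L(A)`, for `y` in `L(A)`. -/
noncomputable def starRight (y : RetractionAlgebra A S) :
    RetractionAlgebra A S →ₗ[A] RetractionAlgebra A S :=
  extendRightMul (perpA A S) y

lemma starRight_eta (y : RetractionAlgebra A S) (a : A) :
    starRight y (etaLinear A S a) = a • y :=
  extendRightMul_eta (perpA A S) y a

lemma retraction_end_ext {f g : RetractionAlgebra A S →ₗ[A] RetractionAlgebra A S}
    (h : ∀ a, f (etaLinear A S a) = g (etaLinear A S a)) : f = g :=
  retraction_hom_ext (Y := perpA A S) h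

/-- The multiplication of `L(A)`: `x ⋆ y` is the image of `x` under the unique extension
`L(A) → L(A)` of `r_y : A → L(A)`. -/
noncomputable instance : Mul (RetractionAlgebra A S) where
  mul x y := starRight y x

noncomputable instance : One (RetractionAlgebra A S) where
  one := etaLinear A S 1

lemma extendRightMul_add (Y : PerpCat A S) (y y' : Y.obj) :
    extendRightMul Y (y + y') = extendRightMul Y y + extendRightMul Y y' :=
  retraction_hom_ext fun a => by simp [extendRightMul_eta]

lemma extendRightMul_zero (Y : PerpCat A S) : extendRightMul Y (0 : Y.obj) = 0 :=
  retraction_hom_ext fun a => by simp [extendRightMul_eta]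

lemma extendRightMul_one (Y : PerpCat A S) (y : Y.obj) :
    extendRightMul Y y (1 : RetractionAlgebra A S) = y :=
  (extendRightMul_eta Y y 1).trans (one_smul A y)

lemma extendRightMul_mul (Y : PerpCat A S) (y : Y.obj) (x x' : RetractionAlgebra A S) :
    extendRightMul Y y (x * x') = extendRightMul Y (extendRightMul Y y x') x := by
  have : extendRightMul Y y ∘ₗ starRight x' = extendRightMul Y (extendRightMul Y y x') :=
    retraction_hom_ext fun a => by
      rw [LinearMap.comp_apply, starRight_eta, extendRightMul_eta, map_smul]
  exact LinearMap.congr_fun this x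

noncomputable instance : Ring (RetractionAlgebra A S) :=
  { (inferInstance : AddCommGroup (RetractionAlgebra A S)),
    (inferInstance : Mul (RetractionAlgebra A S)),
    (inferInstance : One (RetractionAlgebra A S)) with
    left_distrib := fun x y y' =>
      LinearMap.congr_fun (extendRightMul_add (perpA A S) y y') x
    right_distrib := fun x x' y => map_add (starRight y) x x'
    zero_mul := fun y => map_zero (starRight y)
    mul_zero := fun x => LinearMap.congr_fun (extendRightMul_zero (perpA A S)) x
    mul_assoc := fun x y z => (extendRightMul_mul (perpA A S) z x y)
    one_mul := fun y => extendRightMul_one (perpA A S) y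
    mul_one := fun x => by
      have : starRight (etaLinear A S 1) = LinearMap.id :=
        retraction_end_ext fun a => by
          rw [starRight_eta, LinearMap.id_apply, ← map_smul, smul_eq_mul, mul_one]
      exact LinearMap.congr_fun this x }

/-- In terms of the localization functor, `x ⋆ y = L(η_A)⁻¹ (L(r_y) x)`. -/
lemma retraction_mul_eq (x y : RetractionAlgebra A S) :
    (((perpL A S).map ((perpUnit A S).app (FGModuleCat.of A A))).hom.hom (x * y)) =
      ((perpL A S).map (rightMul A ((perpL A S).obj (FGModuleCat.of A A)) y)).hom.hom x := by
  let r : FGModuleCat.of A A ⟶ (perpInclusion A S).obj (perpA A S) := rightMul A _ y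
  have h2 : ((perpAdj A S).homEquiv (FGModuleCat.of A A) (perpA A S)).symm r ≫
      (iLambda A S).map ((perpUnit A S).app (FGModuleCat.of A A)) = (iLambda A S).map r := by
    rw [← cancel_mono ((perpAdj A S).counit.app ((iLambda A S).obj (FGModuleCat.of A A)))]
    rw [Category.assoc, (perpAdj A S).left_triangle_components, Category.comp_id,
      Adjunction.homEquiv_counit]
  exact LinearMap.congr_fun (congrArg (fun f => f.hom.hom.hom) h2) x

variable (A S)

/-- The left retraction `η_A : A → L(A)` of algebras. -/
noncomputable def leftRetraction : A →+* RetractionAlgebra A S :=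
  { (etaLinear A S).toAddMonoidHom with
    map_one' := rfl
    map_mul' := fun a b => by
      change etaLinear A S (a * b) = starRight (etaLinear A S b) (etaLinear A S a)
      rw [starRight_eta, ← map_smul, smul_eq_mul] }

variable {A S}

/-- The `L(A)`-module structure on an object `Y` of `S^⊥`: the action of `x` on `y` is the image
of `x` under the unique extension `L(A) → Y` of `r_y : A → Y`. -/
noncomputable instance (Y : PerpCat A S) : Module (RetractionAlgebra A S) Y.obj where
  smul x y := extendRightMul Y y x
  one_smul y := extendRightMul_one Y y
  mul_smul x x' y := extendRightMul_mul Y y x x'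
  smul_zero x := LinearMap.congr_fun (extendRightMul_zero Y) x
  smul_add x y y' := LinearMap.congr_fun (extendRightMul_add Y y y') x
  add_smul x x' y := map_add (extendRightMul Y y) x x'
  zero_smul y := map_zero (extendRightMul Y y)

/-- The `L(A)`-action extends the `A`-action along `η_A`. -/
lemma leftRetraction_smul (Y : PerpCat A S) (a : A) (y : Y.obj) :
    leftRetraction A S a • y = a • y :=
  extendRightMul_eta Y y a

variable (A S)

/-- The identification of `S^⊥` with `L(A)`-modules. -/
noncomputable def perpToModule : PerpCat A S ⥤ ModuleCat.{u} (RetractionAlgebra A S) where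
  obj Y := ModuleCat.of (RetractionAlgebra A S) Y.obj
  map {Y Z} f := ModuleCat.ofHom
    { toFun := f.hom.hom.hom
      map_add' := map_add f.hom.hom.hom
      map_smul' := fun x y => by
        have : f.hom.hom.hom ∘ₗ extendRightMul Y y = extendRightMul Z (f.hom.hom.hom y) :=
          retraction_hom_ext fun a => by
            rw [LinearMap.comp_apply, extendRightMul_eta, extendRightMul_eta, map_smul]
        exact LinearMap.congr_fun this x }

end Retraction

/-!
For a finitely generated `A`-module `X`, the kernel and the cokernel of the unit `X → L(X)` are
direct sums of copies of `S`. Hence the reflection `i_λ` is exact, and it takes projective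
`A`-modules to projective `L(A)`-modules. As `S` has finite projective dimension over `A`, so does
`L(A)`; consequently, restriction along `η_A` preserves and reflects finiteness of the projective
dimension of finitely generated `L(A)`-modules. Exactness of `i_λ` makes their injective dimensions
over `A` and over `L(A)` equal.

Duality over the artinian base ring turns the right-hand half of the Gorenstein condition into
finiteness of the projective dimension of all finitely generated injective left modules. Over a
Gorenstein algebra, a finitely generated module therefore has finite projective dimension if and
only if it has finite injective dimension.

If `S` has finite injective dimension over `A`, then so do `X` and `L(X)` simultaneously, and the
two algebras are Gorenstein simultaneously. Finally, `S` is exactly the kernel of the surjective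
unit `I → L(I)`, so `S` has finite injective dimension over `A` if and only if `i_λ(I)` has finite
injective dimension over `L(A)`.
-/

section Factorization

variable {A M N Z : Type*} [Ring A] [AddCommGroup M] [Module A M] [AddCommGroup N] [Module A N]
  [AddCommGroup Z] [Module A Z]

lemma exists_comp_eq_of_ker_le {p : M →ₗ[A] N} (hp : Function.Surjective p) {d : M →ₗ[A] Z}
    (hd : LinearMap.ker p ≤ LinearMap.ker d) : ∃ d' : N →ₗ[A] Z, d' ∘ₗ p = d := by
  refine ⟨(LinearMap.ker p).liftQ d hd ∘ₗ (p.quotKerEquivOfSurjective hp).symm.toLinearMap, ?_⟩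
  ext x
  exact congrArg ((LinearMap.ker p).liftQ d hd)
    (LinearMap.quotKerEquivOfSurjective_symm_apply p hp x)

lemma exists_injective_linearMap_pi [IsArtinian A M]
    (h : ∀ x : M, x ≠ 0 → ∃ f : M →ₗ[A] Z, f x ≠ 0) :
    ∃ (n : ℕ) (f : M →ₗ[A] (Fin n → Z)), Function.Injective f := by
  obtain ⟨_, ⟨n, f, rfl⟩, hmin⟩ := IsArtinian.set_has_minimal
    {K : Submodule A M | ∃ (n : ℕ) (f : M →ₗ[A] (Fin n → Z)), LinearMap.ker f = K}
    ⟨_, 0, 0, rfl⟩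
  refine ⟨n, f, (injective_iff_map_eq_zero f).2 fun x hx => ?_⟩
  by_contra hx₀
  obtain ⟨g, hg⟩ := h x hx₀
  refine hmin _ ⟨n + 1, LinearMap.pi (Fin.cons g fun i => LinearMap.proj i ∘ₗ f), rfl⟩
    (lt_of_le_not_ge (fun y hy => funext fun i => ?_) fun hle => hg ?_)
  · exact congrFun (LinearMap.mem_ker.1 hy) i.succ
  · exact congrFun (LinearMap.mem_ker.1 (hle hx)) 0

lemma exact_single_funLeft_succ (n : ℕ) :
    Function.Exact (LinearMap.single A (fun _ : Fin (n + 1) => M) 0)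
      (LinearMap.funLeft A M Fin.succ) := by
  refine fun x => ⟨fun hx => ⟨x 0, funext fun i => ?_⟩, ?_⟩
  · induction i using Fin.cases with
    | zero => rfl
    | succ i => exact (congrFun hx i).symm
  · rintro ⟨m, rfl⟩
    rfl

end Factorization

section InjectiveModule

universe v

variable {A : Type*} [Ring A] {M : Type v} [AddCommGroup M] [Module A M]

lemma exists_retraction_of_injective {N : Type*} [AddCommGroup N] [Module A N] [Small.{v} A]
    [Module.Injective A M] {f : M →ₗ[A] N} (hf : Function.Injective f) :
    ∃ r : N →ₗ[A] M, r ∘ₗ f = LinearMap.id :=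
  Module.Injective.extension_property A M M N f hf LinearMap.id

lemma injective_of_retract {N : Type v} [AddCommGroup N] [Module A N] [hN : Module.Injective A N]
    {s : M →ₗ[A] N} {r : N →ₗ[A] M} (hrs : r ∘ₗ s = LinearMap.id) : Module.Injective A M where
  out X Y _ _ _ _ f hf g := by
    obtain ⟨k, hk⟩ := hN.out f hf (s ∘ₗ g)
    exact ⟨r ∘ₗ k, fun x => (congrArg r (hk x)).trans (LinearMap.congr_fun hrs (g x))⟩

end InjectiveModule

section FiniteDimension

variable (A : Type u) [Ring A]

/-- The module `M` has finite projective dimension. -/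
def FiniteProjDim (M : Type u) [AddCommGroup M] [Module A M] : Prop :=
  projectiveDimension (ModuleCat.of A M) < ⊤

/-- The module `M` has finite injective dimension. -/
def FiniteInjDim (M : Type u) [AddCommGroup M] [Module A M] : Prop :=
  injectiveDimension (ModuleCat.of A M) < ⊤

variable {A} {M N P : Type u} [AddCommGroup M] [Module A M] [AddCommGroup N] [Module A N]
  [AddCommGroup P] [Module A P]

lemma finiteProjDim_iff :
    FiniteProjDim A M ↔ ∃ n, HasProjectiveDimensionLT (ModuleCat.of A M) (n + 1) := by
  rw [FiniteProjDim, lt_top_iff_ne_top, projectiveDimension_ne_top_iff]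

lemma finiteInjDim_iff :
    FiniteInjDim A M ↔ ∃ n, HasInjectiveDimensionLT (ModuleCat.of A M) (n + 1) := by
  rw [FiniteInjDim, lt_top_iff_ne_top, injectiveDimension_ne_top_iff]

lemma hasProjectiveDimensionLT_one_iff_projective :
    HasProjectiveDimensionLT (ModuleCat.of A M) 1 ↔ Module.Projective A M := by
  rw [← projective_iff_hasProjectiveDimensionLT_one, IsProjective.iff_projective]

lemma hasInjectiveDimensionLT_one_iff_injective :
    HasInjectiveDimensionLT (ModuleCat.of A M) 1 ↔ Module.Injective A M := by
  rw [← injective_iff_hasInjectiveDimensionLT_one, Module.injective_iff_injective_object]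

lemma FiniteProjDim.of_projective [Module.Projective A M] : FiniteProjDim A M :=
  finiteProjDim_iff.2 ⟨0, hasProjectiveDimensionLT_one_iff_projective.2 inferInstance⟩

lemma FiniteInjDim.of_injective [Module.Injective A M] : FiniteInjDim A M :=
  finiteInjDim_iff.2 ⟨0, hasInjectiveDimensionLT_one_iff_injective.2 inferInstance⟩

lemma exists_shortExact {f : M →ₗ[A] N} {g : N →ₗ[A] P} (hf : Function.Injective f)
    (hfg : Function.Exact f g) (hg : Function.Surjective g) :
    ∃ h, (ShortComplex.mk (ModuleCat.ofHom f) (ModuleCat.ofHom g) h).ShortExact :=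
  ⟨ModuleCat.hom_ext hfg.linearMap_comp_eq_zero,
    ModuleCat.shortComplex_shortExact _ hfg hf hg⟩

section Exact

variable {f : M →ₗ[A] N} {g : N →ₗ[A] P} (hf : Function.Injective f)
  (hfg : Function.Exact f g) (hg : Function.Surjective g)

include hf hfg hg

lemma FiniteProjDim.of_exact_middle (h₁ : FiniteProjDim A M) (h₃ : FiniteProjDim A P) :
    FiniteProjDim A N := by
  obtain ⟨_, hS⟩ := exists_shortExact hf hfg hg
  obtain ⟨m, hm⟩ := finiteProjDim_iff.1 h₁
  obtain ⟨n, hn⟩ := finiteProjDim_iff.1 h₃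
  exact finiteProjDim_iff.2 ⟨m + n, hS.hasProjectiveDimensionLT_X₂ _
    (hasProjectiveDimensionLT_of_ge _ (m + 1) _ (by lia))
    (hasProjectiveDimensionLT_of_ge _ (n + 1) _ (by lia))⟩

lemma FiniteProjDim.of_exact_right (h₁ : FiniteProjDim A M) (h₂ : FiniteProjDim A N) :
    FiniteProjDim A P := by
  obtain ⟨_, hS⟩ := exists_shortExact hf hfg hg
  obtain ⟨m, hm⟩ := finiteProjDim_iff.1 h₁
  obtain ⟨n, hn⟩ := finiteProjDim_iff.1 h₂
  exact finiteProjDim_iff.2 ⟨m + n + 1, hS.hasProjectiveDimensionLT_X₃ _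
    (hasProjectiveDimensionLT_of_ge _ (m + 1) _ (by lia))
    (hasProjectiveDimensionLT_of_ge _ (n + 1) _ (by lia))⟩

lemma FiniteProjDim.of_exact_left (h₂ : FiniteProjDim A N) (h₃ : FiniteProjDim A P) :
    FiniteProjDim A M := by
  obtain ⟨_, hS⟩ := exists_shortExact hf hfg hg
  obtain ⟨m, hm⟩ := finiteProjDim_iff.1 h₂
  obtain ⟨n, hn⟩ := finiteProjDim_iff.1 h₃
  exact finiteProjDim_iff.2 ⟨m + n, hS.hasProjectiveDimensionLT_X₁ _
    (hasProjectiveDimensionLT_of_ge _ (m + 1) _ (by lia))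
    (hasProjectiveDimensionLT_of_ge _ (n + 1) _ (by lia))⟩

lemma FiniteInjDim.of_exact_middle (h₁ : FiniteInjDim A M) (h₃ : FiniteInjDim A P) :
    FiniteInjDim A N := by
  obtain ⟨_, hS⟩ := exists_shortExact hf hfg hg
  obtain ⟨m, hm⟩ := finiteInjDim_iff.1 h₁
  obtain ⟨n, hn⟩ := finiteInjDim_iff.1 h₃
  exact finiteInjDim_iff.2 ⟨m + n, hS.hasInjectiveDimensionLT_X₂ _
    (hasInjectiveDimensionLT_of_ge _ (m + 1) _ (by lia))
    (hasInjectiveDimensionLT_of_ge _ (n + 1) _ (by lia))⟩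

lemma FiniteInjDim.of_exact_right (h₁ : FiniteInjDim A M) (h₂ : FiniteInjDim A N) :
    FiniteInjDim A P := by
  obtain ⟨_, hS⟩ := exists_shortExact hf hfg hg
  obtain ⟨m, hm⟩ := finiteInjDim_iff.1 h₁
  obtain ⟨n, hn⟩ := finiteInjDim_iff.1 h₂
  exact finiteInjDim_iff.2 ⟨m + n, hS.hasInjectiveDimensionLT_X₃ _
    (hasInjectiveDimensionLT_of_ge _ (n + 1) _ (by lia))
    (hasInjectiveDimensionLT_of_ge _ (m + 1) _ (by lia))⟩

lemma FiniteInjDim.of_exact_left (h₂ : FiniteInjDim A N) (h₃ : FiniteInjDim A P) :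
    FiniteInjDim A M := by
  obtain ⟨_, hS⟩ := exists_shortExact hf hfg hg
  obtain ⟨m, hm⟩ := finiteInjDim_iff.1 h₂
  obtain ⟨n, hn⟩ := finiteInjDim_iff.1 h₃
  exact finiteInjDim_iff.2 ⟨m + n + 1, hS.hasInjectiveDimensionLT_X₁ _
    (hasInjectiveDimensionLT_of_ge _ (n + 1) _ (by lia))
    (hasInjectiveDimensionLT_of_ge _ (m + 1) _ (by lia))⟩

lemma hasProjectiveDimensionLT_right_iff_of_projective [Module.Projective A N] (n : ℕ) :
    HasProjectiveDimensionLT (ModuleCat.of A P) (n + 2) ↔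
      HasProjectiveDimensionLT (ModuleCat.of A M) (n + 1) := by
  obtain ⟨_, hS⟩ := exists_shortExact hf hfg hg
  exact hS.hasProjectiveDimensionLT_X₃_iff n ((IsProjective.iff_projective N).1 inferInstance)

lemma hasInjectiveDimensionLT_left_iff_of_injective [Module.Injective A N] (n : ℕ) :
    HasInjectiveDimensionLT (ModuleCat.of A M) (n + 2) ↔
      HasInjectiveDimensionLT (ModuleCat.of A P) (n + 1) := by
  obtain ⟨_, hS⟩ := exists_shortExact hf hfg hg
  exact (hS.hasInjectiveDimensionLT_X₃_iff n
    ((Module.injective_iff_injective_object A N).1 inferInstance)).symm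

end Exact

lemma FiniteProjDim.of_retract (h : FiniteProjDim A N) {s : M →ₗ[A] N} {r : N →ₗ[A] M}
    (hrs : r ∘ₗ s = LinearMap.id) : FiniteProjDim A M := by
  have e : Retract (ModuleCat.of A M) (ModuleCat.of A N) :=
    ⟨ModuleCat.ofHom s, ModuleCat.ofHom r, ModuleCat.hom_ext hrs⟩
  exact e.projectiveDimension_le.trans_lt h

lemma FiniteInjDim.of_retract (h : FiniteInjDim A N) {s : M →ₗ[A] N} {r : N →ₗ[A] M}
    (hrs : r ∘ₗ s = LinearMap.id) : FiniteInjDim A M := by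
  have e : Retract (ModuleCat.of A M) (ModuleCat.of A N) :=
    ⟨ModuleCat.ofHom s, ModuleCat.ofHom r, ModuleCat.hom_ext hrs⟩
  exact e.injectiveDimension_le.trans_lt h

lemma FiniteProjDim.congr (h : FiniteProjDim A N) (e : M ≃ₗ[A] N) : FiniteProjDim A M :=
  h.of_retract (LinearMap.ext e.symm_apply_apply)

lemma FiniteInjDim.congr (h : FiniteInjDim A N) (e : M ≃ₗ[A] N) : FiniteInjDim A M :=
  h.of_retract (LinearMap.ext e.symm_apply_apply)

lemma FiniteProjDim.pi (h : FiniteProjDim A M) (n : ℕ) : FiniteProjDim A (Fin n → M) := by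
  induction n with
  | zero => exact .of_projective
  | succ n ih =>
    exact .of_exact_middle (Pi.single_injective (M := fun _ => M) 0)
      (exact_single_funLeft_succ n)
      (LinearMap.funLeft_surjective_of_injective A M _ (Fin.succ_injective n)) h ih

lemma FiniteInjDim.pi (h : FiniteInjDim A M) (n : ℕ) : FiniteInjDim A (Fin n → M) := by
  induction n with
  | zero =>
    have : Module.Injective A (Fin 0 → M) :=
      ⟨fun _ _ _ _ _ _ _ _ _ => ⟨0, fun _ => Subsingleton.elim _ _⟩⟩
    exact .of_injective
  | succ n ih =>
    exact .of_exact_middle (Pi.single_injective (M := fun _ => M) 0)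
      (exact_single_funLeft_succ n)
      (LinearMap.funLeft_surjective_of_injective A M _ (Fin.succ_injective n)) h ih

section KernelCokernel

variable {f : M →ₗ[A] N}

lemma exact_subtype_rangeRestrict (f : M →ₗ[A] N) :
    Function.Exact (LinearMap.ker f).subtype f.rangeRestrict :=
  LinearMap.exact_iff.2 (by rw [LinearMap.ker_rangeRestrict, Submodule.range_subtype])

lemma finiteProjDim_iff_of_ker_of_coker (hker : FiniteProjDim A (LinearMap.ker f))
    (hcoker : FiniteProjDim A (N ⧸ LinearMap.range f)) :
    FiniteProjDim A M ↔ FiniteProjDim A N := by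
  have hexact := exact_subtype_rangeRestrict f
  have hsurj := f.surjective_rangeRestrict
  have hrange : FiniteProjDim A M ↔ FiniteProjDim A (LinearMap.range f) :=
    ⟨.of_exact_right (Submodule.subtype_injective _) hexact hsurj hker,
      .of_exact_middle (Submodule.subtype_injective _) hexact hsurj hker⟩
  have hexact' := LinearMap.exact_subtype_mkQ (LinearMap.range f)
  have hsurj' := (LinearMap.range f).mkQ_surjective
  exact hrange.trans
    ⟨fun h => .of_exact_middle (Submodule.subtype_injective _) hexact' hsurj' h hcoker,
      fun h => .of_exact_left (Submodule.subtype_injective _) hexact' hsurj' h hcoker⟩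

lemma finiteInjDim_iff_of_ker_of_coker (hker : FiniteInjDim A (LinearMap.ker f))
    (hcoker : FiniteInjDim A (N ⧸ LinearMap.range f)) :
    FiniteInjDim A M ↔ FiniteInjDim A N := by
  have hexact := exact_subtype_rangeRestrict f
  have hsurj := f.surjective_rangeRestrict
  have hrange : FiniteInjDim A M ↔ FiniteInjDim A (LinearMap.range f) :=
    ⟨.of_exact_right (Submodule.subtype_injective _) hexact hsurj hker,
      .of_exact_middle (Submodule.subtype_injective _) hexact hsurj hker⟩
  have hexact' := LinearMap.exact_subtype_mkQ (LinearMap.range f)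
  have hsurj' := (LinearMap.range f).mkQ_surjective
  exact hrange.trans
    ⟨fun h => .of_exact_middle (Submodule.subtype_injective _) hexact' hsurj' h hcoker,
      fun h => .of_exact_left (Submodule.subtype_injective _) hexact' hsurj' h hcoker⟩

end KernelCokernel

lemma FiniteProjDim.finite_induction [IsNoetherianRing A]
    {motive : ∀ (M : Type u) [AddCommGroup M] [Module A M], Prop}
    (projective : ∀ (M : Type u) [AddCommGroup M] [Module A M] [Module.Finite A M]
      [Module.Projective A M], motive M)
    (presentation : ∀ (M : Type u) [AddCommGroup M] [Module A M] [Module.Finite A M] (n : ℕ)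
      (π : (Fin n → A) →ₗ[A] M), Function.Surjective π → motive (LinearMap.ker π) → motive M)
    (M : Type u) [AddCommGroup M] [Module A M] [Module.Finite A M] (h : FiniteProjDim A M) :
    motive M := by
  obtain ⟨n, hn⟩ := finiteProjDim_iff.1 h
  clear h
  induction n generalizing M with
  | zero =>
    have := hasProjectiveDimensionLT_one_iff_projective.1 hn
    exact projective M
  | succ n ih =>
    obtain ⟨k, π, hπ⟩ := Module.Finite.exists_fin' A M
    exact presentation M k π hπ (ih _ ((hasProjectiveDimensionLT_right_iff_of_projective
      (LinearMap.ker π).subtype_injective (LinearMap.exact_subtype_ker_map π) hπ n).1 hn))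

lemma FiniteProjDim.finiteInjDim [IsNoetherianRing A] (hA : FiniteInjDim A A) [Module.Finite A M]
    (h : FiniteProjDim A M) : FiniteInjDim A M := by
  refine FiniteProjDim.finite_induction (motive := fun M _ _ => FiniteInjDim A M) ?_ ?_ M h
  · intro M _ _ _ _
    obtain ⟨k, π, hπ⟩ := Module.Finite.exists_fin' A M
    obtain ⟨_, hs⟩ := Module.projective_lifting_property π LinearMap.id hπ
    exact (hA.pi k).of_retract hs
  · intro M _ _ _ k π hπ hK
    exact .of_exact_right (LinearMap.ker π).subtype_injective (LinearMap.exact_subtype_ker_map π)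
      hπ hK (hA.pi k)

end FiniteDimension

section EssentialExtension

universe v

variable {A : Type*} [Ring A] {J : Type*} [AddCommGroup J] [Module A J] {N E F : Submodule A J}

/-- The submodule `E` is an essential extension of `N`, expressed on elements so that the
condition passes to unions of chains; the inclusion `N ≤ E` is not part of the definition. -/
def IsEssentialOver (N E : Submodule A J) : Prop :=
  ∀ x ∈ E, x ≠ 0 → ∃ a : A, a • x ∈ N ∧ a • x ≠ 0

lemma isEssentialOver_self (N : Submodule A J) : IsEssentialOver N N := fun x hx hx₀ =>
  ⟨1, by rwa [one_smul], by rwa [one_smul]⟩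

lemma IsEssentialOver.trans (hNE : IsEssentialOver N E) (hEF : IsEssentialOver E F) :
    IsEssentialOver N F := fun x hx hx₀ => by
  obtain ⟨a, ha, ha₀⟩ := hEF x hx hx₀
  obtain ⟨b, hb, hb₀⟩ := hNE _ ha ha₀
  exact ⟨b * a, by rwa [mul_smul], by rwa [mul_smul]⟩

lemma IsEssentialOver.map_range {Q : Type*} [AddCommGroup Q] [Module A Q] {P : Submodule A Q}
    (hP : IsEssentialOver P ⊤) {g : Q →ₗ[A] J} (hg : Set.InjOn g P) :
    IsEssentialOver (P.map g) (LinearMap.range g) := by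
  rintro _ ⟨y, rfl⟩ hy₀
  obtain ⟨a, ha, ha₀⟩ := hP y trivial fun h => hy₀ (by rw [h, map_zero])
  refine ⟨a, map_smul g a y ▸ Submodule.mem_map_of_mem ha, fun h => ha₀ ?_⟩
  exact hg ha P.zero_mem ((map_smul g a y).trans (h.trans (map_zero g).symm))

lemma exists_maximal_submodule {p : J → Prop} (hN : ∀ x ∈ N, p x) :
    ∃ E : Submodule A J, N ≤ E ∧ Maximal (fun E : Submodule A J => ∀ x ∈ E, p x) E := by
  refine zorn_le_nonempty₀ {E : Submodule A J | ∀ x ∈ E, p x} (fun c hc hchain E hE => ?_) N hN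
  refine ⟨sSup c, fun x hx => ?_, fun z hz => le_sSup hz⟩
  obtain ⟨F, hF, hxF⟩ := (Submodule.mem_sSup_of_directed ⟨E, hE⟩ hchain.directedOn).1 hx
  exact hc hF x hxF

lemma exists_disjoint_isEssentialOver (E : Submodule A J) :
    ∃ C : Submodule A J, Disjoint C E ∧ IsEssentialOver (E.map C.mkQ) ⊤ := by
  obtain ⟨C, -, hC⟩ := exists_maximal_submodule (N := (⊥ : Submodule A J))
    (p := fun x => x ∈ E → x = 0) fun x hx _ => (Submodule.mem_bot A).1 hx
  refine ⟨C, Submodule.disjoint_def.2 hC.1, fun y _ hy₀ => ?_⟩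
  obtain ⟨x, rfl⟩ := C.mkQ_surjective y
  have hxC : ¬ C ⊔ Submodule.span A {x} ≤ C := fun h =>
    hy₀ ((Submodule.Quotient.mk_eq_zero C).2
      (h (Submodule.mem_sup_right (Submodule.mem_span_singleton_self x))))
  obtain ⟨z, hz, hzE, hz₀⟩ : ∃ z ∈ C ⊔ Submodule.span A {x}, z ∈ E ∧ z ≠ 0 := by
    by_contra! h
    exact hxC (hC.2 h le_sup_left)
  obtain ⟨c, hc, w, hw, rfl⟩ := Submodule.mem_sup.1 hz
  obtain ⟨a, rfl⟩ := Submodule.mem_span_singleton.1 hw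
  have hax : C.mkQ (c + a • x) = a • C.mkQ x := by
    rw [map_add, map_smul, Submodule.mkQ_apply C c, (Submodule.Quotient.mk_eq_zero C).2 hc,
      zero_add]
  refine ⟨a, hax ▸ Submodule.mem_map_of_mem hzE, fun h => hz₀ (hC.1 _ ?_ hzE)⟩
  exact (Submodule.Quotient.mk_eq_zero C).1 (hax.trans h)

lemma exists_retraction_of_maximal_isEssentialOver {J : Type v} [AddCommGroup J] [Module A J]
    [Small.{v} A] [Module.Injective A J] {N E : Submodule A J}
    (hE : Maximal (IsEssentialOver N) E) : ∃ r : J →ₗ[A] E, r ∘ₗ E.subtype = LinearMap.id := by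
  obtain ⟨C, hCE, hess⟩ := exists_disjoint_isEssentialOver E
  have hinj : Function.Injective (C.mkQ.domRestrict E) := by
    rw [LinearMap.injective_domRestrict_iff, Submodule.ker_mkQ]
    exact hCE.symm
  obtain ⟨g, hg⟩ := Module.Injective.extension_property A J E (J ⧸ C) _ hinj E.subtype
  have hgE (x : J) (hx : x ∈ E) : g (C.mkQ x) = x := LinearMap.congr_fun hg ⟨x, hx⟩
  have hmap : (E.map C.mkQ).map g = E := by
    rw [← Submodule.map_comp]
    ext y
    exact ⟨fun ⟨x, hx, hxy⟩ => hxy ▸ (hgE x hx).symm ▸ hx, fun hy => ⟨y, hy, hgE y hy⟩⟩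
  have hinjOn : Set.InjOn g (E.map C.mkQ) := by
    rintro _ ⟨x, hx, rfl⟩ _ ⟨y, hy, rfl⟩ hxy
    rw [hgE x hx, hgE y hy] at hxy
    rw [hxy]
  have hrange : LinearMap.range g ≤ E :=
    hE.2 (hE.1.trans (hmap ▸ hess.map_range hinjOn)) (hmap ▸ LinearMap.map_le_range)
  exact ⟨(g ∘ₗ C.mkQ).codRestrict E fun x => hrange ⟨_, rfl⟩,
    LinearMap.ext fun x => Subtype.ext (hgE x x.2)⟩

end EssentialExtension

section InjectiveEnvelope

variable {A : Type u} [Ring A]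

lemma exists_injective_embedding (M : Type u) [AddCommGroup M] [Module A M] :
    ∃ (J : Type u) (_ : AddCommGroup J) (_ : Module A J) (f : M →ₗ[A] J),
      Module.Injective A J ∧ Function.Injective f := by
  obtain ⟨⟨J, hJ, f, hf⟩⟩ := EnoughInjectives.presentation (ModuleCat.of A M)
  exact ⟨J, inferInstance, inferInstance, f.hom,
    (Module.injective_iff_injective_object A J).2 hJ, (ModuleCat.mono_iff_injective f).1 hf⟩

theorem exists_isInjectiveEnvelope (M : Type u) [AddCommGroup M] [Module A M] :
    ∃ (E : Type u) (_ : AddCommGroup E) (_ : Module A E) (ι : M →ₗ[A] E),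
      IsInjectiveEnvelope ι := by
  obtain ⟨J, _, _, f, _, hf⟩ := exists_injective_embedding (A := A) M
  obtain ⟨E, hfE, hE⟩ := exists_maximal_submodule (isEssentialOver_self (LinearMap.range f))
  obtain ⟨r, hr⟩ := exists_retraction_of_maximal_isEssentialOver hE
  refine ⟨E, inferInstance, inferInstance, f.codRestrict E fun x => hfE ⟨x, rfl⟩,
    injective_of_retract hr, fun x y h => hf (congrArg Subtype.val h), fun N hN => ?_⟩
  rw [Submodule.eq_bot_iff]
  intro x hx
  by_contra hx₀
  obtain ⟨a, ⟨m, hm⟩, ha₀⟩ := hE.1 x x.2 fun h => hx₀ (Subtype.ext h)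
  have hmem : a • x ∈ N ⊓ LinearMap.range (f.codRestrict E fun x => hfE ⟨x, rfl⟩) :=
    ⟨N.smul_mem a hx, m, Subtype.ext hm⟩
  rw [hN, Submodule.mem_bot] at hmem
  exact ha₀ (congrArg Subtype.val hmem)

lemma IsInjectiveEnvelope.apply_mem_range {M I : Type u} {S : Type*} [AddCommGroup M] [Module A M]
    [AddCommGroup I] [Module A I] [AddCommGroup S] [Module A S] [IsSimpleModule A S]
    {ι : M →ₗ[A] I} (hι : IsInjectiveEnvelope ι) (g : S →ₗ[A] I) (s : S) :
    g s ∈ LinearMap.range ι := by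
  rcases eq_bot_or_eq_top (Submodule.comap g (LinearMap.range ι)) with hbot | htop
  · have hg : LinearMap.range g = ⊥ :=
      hι.essential _ (by rw [← Submodule.map_comap_eq, hbot, Submodule.map_bot])
    have hgs : g s = 0 := (Submodule.mem_bot A).1 (hg ▸ LinearMap.mem_range_self g s)
    exact hgs ▸ zero_mem _
  · exact Submodule.eq_top_iff'.1 htop s

end InjectiveEnvelope

section MatlisDuality

variable (R : Type u) [CommRing R]

/-- The product of the residue fields of `R`. For an artinian ring it contains each simple module
exactly once, so that its injective envelope is the minimal injective cogenerator. -/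
abbrev ResidueProduct : Type u := ∀ m : MaximalSpectrum R, R ⧸ m.asIdeal

variable {R}

namespace ResidueProduct

lemma apply_eq_zero_of_ne {m n : MaximalSpectrum R} {x : ResidueProduct R}
    (hx : ∀ r ∈ m.asIdeal, r • x = 0) (hn : n ≠ m) : x n = 0 := by
  have hle : ¬ m.asIdeal ≤ n.asIdeal := fun h =>
    hn (MaximalSpectrum.ext (m.isMaximal.eq_of_le n.isMaximal.ne_top h).symm)
  obtain ⟨r, hr, hrn⟩ := SetLike.not_le_iff_exists.1 hle
  have hrx : Ideal.Quotient.mk n.asIdeal r * x n = 0 := congrFun (hx r hr) n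
  have := n.isMaximal.isPrime
  exact (mul_eq_zero.1 hrx).resolve_left fun h => hrn (Ideal.Quotient.eq_zero_iff_mem.1 h)

lemma exists_smul_eq {m : MaximalSpectrum R} {x y : ResidueProduct R}
    (hx : ∀ r ∈ m.asIdeal, r • x = 0) (hy : ∀ r ∈ m.asIdeal, r • y = 0) (hx₀ : x ≠ 0) :
    ∃ r : R, r • x = y := by
  have hxm : x m ≠ 0 := fun h => hx₀ <| funext fun n => by
    rcases eq_or_ne n m with rfl | hn
    exacts [h, apply_eq_zero_of_ne hx hn]
  let _ := Ideal.Quotient.field m.asIdeal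
  obtain ⟨r, hr⟩ := Ideal.Quotient.mk_surjective (y m * (x m)⁻¹)
  refine ⟨r, funext fun n => ?_⟩
  rcases eq_or_ne n m with rfl | hn
  · change Ideal.Quotient.mk n.asIdeal r * x n = y n
    rw [hr, inv_mul_cancel_right₀ hxm]
  · rw [Pi.smul_apply, apply_eq_zero_of_ne hx hn, apply_eq_zero_of_ne hy hn, smul_zero]

end ResidueProduct

lemma exists_linearMap_ne_zero_of_injective {A : Type*} [Ring A] [Small.{u} A] {E M : Type u}
    [AddCommGroup E] [Module A E] [Module.Injective A E] [AddCommGroup M] [Module A M]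
    (h : ∀ m : Ideal A, m.IsMaximal → ∃ e : E, e ≠ 0 ∧ ∀ r ∈ m, r • e = 0)
    {x : M} (hx : x ≠ 0) : ∃ f : M →ₗ[A] E, f x ≠ 0 := by
  let t := LinearMap.toSpanSingleton A M x
  have ht : LinearMap.ker t ≠ ⊤ := fun htop => hx <| by
    have hone : (1 : A) ∈ LinearMap.ker t := htop ▸ Submodule.mem_top
    rwa [LinearMap.mem_ker, LinearMap.toSpanSingleton_apply_one] at hone
  obtain ⟨m, hm, htm⟩ := Ideal.exists_le_maximal (LinearMap.ker t) ht
  obtain ⟨e, he₀, he⟩ := h m hm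
  obtain ⟨g, hg⟩ := exists_comp_eq_of_ker_le t.surjective_rangeRestrict
    (d := LinearMap.toSpanSingleton A E e) fun r hr => he r (htm (t.ker_rangeRestrict ▸ hr))
  obtain ⟨f, hf⟩ := Module.Injective.extension_property A E _ M (LinearMap.range t).subtype
    (LinearMap.range t).subtype_injective g
  refine ⟨f, fun hfx => he₀ ?_⟩
  calc e = g (t.rangeRestrict 1) := by
        rw [← LinearMap.comp_apply, hg, LinearMap.toSpanSingleton_apply_one]
    _ = f (t 1) := (LinearMap.congr_fun hf _).symm
    _ = 0 := by rw [LinearMap.toSpanSingleton_apply_one, hfx]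

/-- A dualizing module for finitely generated modules over a commutative artinian ring: an
injective cogenerator `E` such that `Hom(-, E)` preserves finiteness and is reflexive. -/
structure IsMatlisModule (R : Type u) [CommRing R] (E : Type u) [AddCommGroup E] [Module R E] :
    Prop where
  injective : Module.Injective R E
  exists_ne_zero : ∀ (M : Type u) [AddCommGroup M] [Module R M] (x : M), x ≠ 0 →
    ∃ f : M →ₗ[R] E, f x ≠ 0
  finite_hom : ∀ (M : Type u) [AddCommGroup M] [Module R M] [Module.Finite R M],
    Module.Finite R (M →ₗ[R] E)
  bijective_eval : ∀ (M : Type u) [AddCommGroup M] [Module R M] [Module.Finite R M],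
    Function.Bijective (LinearMap.applyₗ (R := R) (M := M) (M₂ := E))

variable {E : Type u} [AddCommGroup E] [Module R E]

namespace IsInjectiveEnvelope

variable {ι : ResidueProduct R →ₗ[R] E}

lemma exists_apply_ne_zero (hι : IsInjectiveEnvelope ι) {M : Type u} [AddCommGroup M] [Module R M]
    {x : M} (hx : x ≠ 0) : ∃ f : M →ₗ[R] E, f x ≠ 0 := by
  classical
  have := hι.moduleInjective
  refine exists_linearMap_ne_zero_of_injective (fun m hm => ?_) hx
  have := hm
  let z : ResidueProduct R := Pi.single ⟨m, hm⟩ 1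
  refine ⟨ι z, fun h => ?_, fun r hr => ?_⟩
  · have hz : z = 0 := hι.injective (h.trans (map_zero ι).symm)
    exact one_ne_zero ((Pi.single_eq_same _ _).symm.trans (congrFun hz ⟨m, hm⟩))
  · have hrz : r • z = 0 := by
      rw [← Pi.single_smul, Algebra.smul_def, mul_one]
      exact (congrArg _ (Ideal.Quotient.eq_zero_iff_mem.2 hr)).trans (Pi.single_zero _)
    rw [← map_smul, hrz, map_zero]

lemma length_hom_le_one (hι : IsInjectiveEnvelope ι) (T : Type u) [AddCommGroup T] [Module R T]
    [IsSimpleModule R T] : Module.length R (T →ₗ[R] E) ≤ 1 := by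
  rcases subsingleton_or_nontrivial (T →ₗ[R] E) with _ | hnontrivial
  · exact (Module.length_eq_zero (R := R) (M := T →ₗ[R] E)).trans_le zero_le_one
  refine (Module.length_eq_one_iff.2 ?_).le
  rw [isSimpleModule_iff_toSpanSingleton_surjective]
  refine ⟨hnontrivial, fun f hf g => ?_⟩
  have := IsSimpleModule.nontrivial R T
  obtain ⟨t, ht⟩ := exists_ne (0 : T)
  have hspan {k l : T →ₗ[R] E} (h : k t = l t) : k = l := by
    ext s
    obtain ⟨a, rfl⟩ := IsSimpleModule.toSpanSingleton_surjective R ht s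
    rw [LinearMap.toSpanSingleton_apply, map_smul, map_smul, h]
  let m : MaximalSpectrum R := ⟨_, IsSimpleModule.ker_toSpanSingleton_isMaximal R ht⟩
  have hann {k : T →ₗ[R] E} {z : ResidueProduct R} (hz : ι z = k t) (r : R)
      (hr : r ∈ m.asIdeal) : r • z = 0 := by
    have hrt : r • t = 0 := hr
    exact hι.injective (by rw [map_smul, hz, ← map_smul, hrt, map_zero, map_zero])
  obtain ⟨x, hx⟩ := hι.apply_mem_range f t
  obtain ⟨y, hy⟩ := hι.apply_mem_range g t
  have hx₀ : x ≠ 0 := fun h => hf (hspan (by rw [← hx, h, map_zero, LinearMap.zero_apply]))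
  obtain ⟨r, hr⟩ := ResidueProduct.exists_smul_eq (hann hx) (hann hy) hx₀
  exact ⟨r, hspan (by
    rw [LinearMap.toSpanSingleton_apply, LinearMap.smul_apply, ← hx, ← hy, ← map_smul, hr])⟩

end IsInjectiveEnvelope

lemma length_hom_le [hE : Module.Injective R E]
    (hsimple : ∀ (T : Type u) [AddCommGroup T] [Module R T] [IsSimpleModule R T],
      Module.length R (T →ₗ[R] E) ≤ 1)
    {M : Type u} [AddCommGroup M] [Module R M] (hM : IsFiniteLength R M) :
    Module.length R (M →ₗ[R] E) ≤ Module.length R M := by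
  induction hM with
  | of_subsingleton => rw [Module.length_eq_zero]; exact bot_le
  | @of_simple_quotient M _ _ N _ _ ih =>
    have hexact := LinearMap.exact_lcomp_of_exact_of_surjective E
      (LinearMap.exact_subtype_mkQ N) N.mkQ_surjective
    have hsurj : Function.Surjective (LinearMap.lcomp R E N.subtype) :=
      Module.Injective.extension_property R E N M N.subtype N.subtype_injective
    calc Module.length R (M →ₗ[R] E)
        = Module.length R ((M ⧸ N) →ₗ[R] E) + Module.length R (N →ₗ[R] E) :=
          Module.length_eq_add_of_exact _ _
            (LinearMap.lcomp_injective_of_surjective _ N.mkQ_surjective) hsurj hexact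
      _ ≤ Module.length R (M ⧸ N) + Module.length R N :=
          add_le_add ((hsimple _).trans_eq (Module.length_eq_one R (M ⧸ N)).symm) ih
      _ = Module.length R M := by
          rw [add_comm, Module.length_eq_add_of_exact N.subtype N.mkQ N.subtype_injective
            N.mkQ_surjective (LinearMap.exact_subtype_mkQ N)]

section Artinian

variable [IsArtinianRing R]

lemma isFiniteLength_of_finite (M : Type*) [AddCommGroup M] [Module R M] [Module.Finite R M] :
    IsFiniteLength R M :=
  isFiniteLength_iff_isNoetherian_isArtinian.2 ⟨inferInstance, inferInstance⟩

lemma finite_hom_of_length_hom_le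
    (h : ∀ (M : Type u) [AddCommGroup M] [Module R M] [Module.Finite R M],
      Module.length R (M →ₗ[R] E) ≤ Module.length R M)
    (M : Type u) [AddCommGroup M] [Module R M] [Module.Finite R M] :
    Module.Finite R (M →ₗ[R] E) := by
  have hM := Module.length_ne_top_iff.2 (isFiniteLength_of_finite (R := R) M)
  have hfin := Module.length_ne_top_iff.1 (ne_top_of_le_ne_top hM (h M))
  have := (isFiniteLength_iff_isNoetherian_isArtinian.1 hfin).1
  infer_instance

lemma bijective_eval_of_length_hom_le
    (hcogen : ∀ (M : Type u) [AddCommGroup M] [Module R M] (x : M), x ≠ 0 →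
      ∃ f : M →ₗ[R] E, f x ≠ 0)
    (h : ∀ (M : Type u) [AddCommGroup M] [Module R M] [Module.Finite R M],
      Module.length R (M →ₗ[R] E) ≤ Module.length R M)
    (M : Type u) [AddCommGroup M] [Module R M] [Module.Finite R M] :
    Function.Bijective (LinearMap.applyₗ (R := R) (M := M) (M₂ := E)) := by
  have hinj : Function.Injective (LinearMap.applyₗ (R := R) (M := M) (M₂ := E)) := by
    refine (injective_iff_map_eq_zero _).2 fun x hx => ?_
    by_contra hx₀
    obtain ⟨f, hf⟩ := hcogen M x hx₀
    exact hf (LinearMap.congr_fun hx f)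
  have := finite_hom_of_length_hom_le h M
  have := finite_hom_of_length_hom_le h (M →ₗ[R] E)
  refine ⟨hinj, LinearMap.range_eq_top.1 ?_⟩
  by_contra hrange
  have hlt := Submodule.length_lt hrange
  rw [← (LinearEquiv.ofInjective _ hinj).length_eq] at hlt
  exact absurd ((h _).trans (h M)) (not_le_of_gt hlt)

theorem exists_isMatlisModule (R : Type u) [CommRing R] [IsArtinianRing R] :
    ∃ (E : Type u) (_ : AddCommGroup E) (_ : Module R E), IsMatlisModule R E := by
  obtain ⟨E, _, _, ι, hι⟩ := exists_isInjectiveEnvelope (A := R) (ResidueProduct R)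
  have := hι.moduleInjective
  have hlength (M : Type u) [AddCommGroup M] [Module R M] [Module.Finite R M] :
      Module.length R (M →ₗ[R] E) ≤ Module.length R M :=
    length_hom_le hι.length_hom_le_one (isFiniteLength_of_finite M)
  exact ⟨E, inferInstance, inferInstance, this, fun M _ _ _ => hι.exists_apply_ne_zero,
    finite_hom_of_length_hom_le hlength,
    bijective_eval_of_length_hom_le (fun M _ _ _ => hι.exists_apply_ne_zero) hlength⟩

end Artinian

end MatlisDuality

section ArtinDuality

open MulOpposite

variable {R A E : Type u} [CommRing R] [Ring A] [Algebra R A] [AddCommGroup E] [Module R E]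

lemma injective_of_coinduced {D : Type u} [AddCommGroup D] [Module A D] [Module R D]
    [IsScalarTower R A D] [Module.Injective R E] (ε : D →ₗ[R] E)
    (hε : ∀ d, (∀ a : A, ε (a • d) = 0) → d = 0)
    (h : ∀ φ : A →ₗ[R] E, ∃ d, ∀ a : A, ε (a • d) = φ a) : Module.Injective A D := by
  refine Module.Baer.injective fun K g => ?_
  obtain ⟨φ, hφ⟩ := Module.Injective.extension_property R E K A (K.subtype.restrictScalars R)
    K.subtype_injective (ε ∘ₗ g.restrictScalars R)
  obtain ⟨d, hd⟩ := h φ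
  refine ⟨LinearMap.toSpanSingleton A D d, fun x hx => sub_eq_zero.1 (hε _ fun a => ?_)⟩
  rw [smul_sub, map_sub, sub_eq_zero, LinearMap.toSpanSingleton_apply, ← mul_smul, hd,
    ← map_smul g]
  exact LinearMap.congr_fun hφ (a • ⟨x, hx⟩)

/-- The left `A`-module structure `(a • f) x = f (x * a)` on the dual `Hom_R(A, E)` of the right
module `A`. -/
@[reducible] def regularDualModule (R A E : Type u) [CommRing R] [Ring A] [Algebra R A]
    [AddCommGroup E] [Module R E] : Module A (A →ₗ[R] E) where
  smul a f := f ∘ₗ LinearMap.mulRight R a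
  one_smul f := LinearMap.ext fun x => congrArg f (mul_one x)
  mul_smul a b f := LinearMap.ext fun x => congrArg f (mul_assoc x a b).symm
  smul_zero _ := rfl
  smul_add _ _ _ := rfl
  add_smul a b f := LinearMap.ext fun x => (congrArg f (mul_add x a b)).trans (map_add f _ _)
  zero_smul f := LinearMap.ext fun x => (congrArg f (mul_zero x)).trans (map_zero f)

/-- The right `A`-module structure `(f • a) x = f (a • x)` on the dual `Hom_R(M, E)` of a left
`A`-module `M`. -/
@[reducible] def dualModule (R A E M : Type u) [CommRing R] [Ring A] [Algebra R A]
    [AddCommGroup E] [Module R E] [AddCommGroup M] [Module A M] [Module R M]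
    [IsScalarTower R A M] : Module Aᵐᵒᵖ (M →ₗ[R] E) :=
  inferInstanceAs (Module Aᵈᵐᵃ (M →ₗ[R] E))

attribute [local instance] regularDualModule dualModule

lemma isScalarTower_regularDual : IsScalarTower R A (A →ₗ[R] E) where
  smul_assoc r a f := LinearMap.ext fun x =>
    (congrArg f (mul_smul_comm r x a)).trans (map_smul f r (x * a))

attribute [local instance] isScalarTower_regularDual

lemma dual_smul_apply {M : Type u} [AddCommGroup M] [Module A M] [Module R M]
    [IsScalarTower R A M] (a : Aᵐᵒᵖ) (f : M →ₗ[R] E) (x : M) : (a • f) x = f (a.unop • x) := rfl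

lemma isScalarTower_dual {M : Type u} [AddCommGroup M] [Module A M] [Module R M]
    [IsScalarTower R A M] : IsScalarTower R Aᵐᵒᵖ (M →ₗ[R] E) where
  smul_assoc r a f := LinearMap.ext fun x =>
    (congrArg f (smul_assoc r a.unop x)).trans (map_smul f r (a.unop • x))

attribute [local instance] isScalarTower_dual

lemma regularDual_injective [Module.Injective R E] : Module.Injective A (A →ₗ[R] E) := by
  refine injective_of_coinduced (R := R) (E := E) (LinearMap.applyₗ 1)
    (fun f hf => LinearMap.ext fun a => ?_) fun φ => ⟨φ, fun a => congrArg φ (one_mul a)⟩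
  exact (congrArg f (one_mul a)).symm.trans (hf a)

section

variable {M N P : Type u} [AddCommGroup M] [Module A M] [Module R M] [IsScalarTower R A M]
  [AddCommGroup N] [Module A N] [Module R N] [IsScalarTower R A N]
  [AddCommGroup P] [Module A P] [Module R P] [IsScalarTower R A P]

/-- The `A`-linear map into `Hom_R(A, E)` corresponding to an `R`-linear map into `E`. -/
def coinducedLift (f : M →ₗ[R] E) : M →ₗ[A] (A →ₗ[R] E) where
  toFun m := f ∘ₗ (LinearMap.toSpanSingleton A M m).restrictScalars R
  map_add' m m' := LinearMap.ext fun a =>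
    (congrArg f (smul_add a m m')).trans (map_add f _ _)
  map_smul' b m := LinearMap.ext fun a => congrArg f (mul_smul a b m).symm

lemma coinducedLift_apply_one (f : M →ₗ[R] E) (m : M) : coinducedLift (A := A) f m 1 = f m :=
  congrArg f (one_smul A m)

/-- The transpose `Hom_R(N, E) → Hom_R(M, E)` of an `A`-linear map `M → N`. -/
def dualTranspose (R E : Type u) [CommRing R] [Algebra R A] [AddCommGroup E] [Module R E]
    [Module R M] [IsScalarTower R A M] [Module R N] [IsScalarTower R A N]
    (φ : M →ₗ[A] N) : (N →ₗ[R] E) →ₗ[Aᵐᵒᵖ] (M →ₗ[R] E) where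
  toFun f := f ∘ₗ φ.restrictScalars R
  map_add' _ _ := rfl
  map_smul' a f := LinearMap.ext fun x => congrArg f (map_smul φ a.unop x).symm

lemma dualTranspose_injective {φ : M →ₗ[A] N} (hφ : Function.Surjective φ) :
    Function.Injective (dualTranspose R E φ) := fun _ _ h =>
  LinearMap.ext (hφ.forall.2 fun x => LinearMap.congr_fun h x)

lemma dualTranspose_surjective [Module.Injective R E] {φ : M →ₗ[A] N}
    (hφ : Function.Injective φ) : Function.Surjective (dualTranspose R E φ) :=
  Module.Injective.extension_property R E M N (φ.restrictScalars R) hφ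

lemma dualTranspose_exact {φ : M →ₗ[A] N} {ψ : N →ₗ[A] P} (hφψ : Function.Exact φ ψ)
    (hψ : Function.Surjective ψ) :
    Function.Exact (dualTranspose R E ψ) (dualTranspose R E φ) :=
  LinearMap.exact_lcomp_of_exact_of_surjective E (f := φ.restrictScalars R)
    (g := ψ.restrictScalars R) hφψ hψ

end

namespace IsMatlisModule

variable (hE : IsMatlisModule R E)

include hE

lemma ext_eval {M : Type u} [AddCommGroup M] [Module R M] {x y : M}
    (h : ∀ f : M →ₗ[R] E, f x = f y) : x = y := by
  by_contra hxy
  obtain ⟨f, hf⟩ := hE.exists_ne_zero M (x - y) (sub_ne_zero.2 hxy)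
  exact hf (by rw [map_sub, h f, sub_self])

section

variable {M N : Type u} [AddCommGroup M] [Module A M] [Module R M] [IsScalarTower R A M]
  [AddCommGroup N] [Module A N] [Module R N] [IsScalarTower R A N]

lemma exists_dualTranspose_eq [Module.Finite R N]
    (s : (N →ₗ[R] E) →ₗ[Aᵐᵒᵖ] (M →ₗ[R] E)) : ∃ σ : M →ₗ[A] N, dualTranspose R E σ = s := by
  choose σ hσ using fun x : M =>
    (hE.bijective_eval N).2 (LinearMap.applyₗ x ∘ₗ s.restrictScalars R)
  have hσs (x : M) (f : N →ₗ[R] E) : f (σ x) = s f x := LinearMap.congr_fun (hσ x) f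
  refine ⟨{ toFun := σ, map_add' := fun x y => ?_, map_smul' := fun a x => ?_ },
    LinearMap.ext fun f => LinearMap.ext fun x => hσs x f⟩
  · exact hE.ext_eval fun f => by rw [map_add, hσs, hσs, hσs, map_add]
  · refine hE.ext_eval fun f => ?_
    have hsmul := hσs x (op a • f)
    rw [map_smul, dual_smul_apply, dual_smul_apply, unop_op] at hsmul
    rw [hσs, RingHom.id_apply, hsmul]

lemma dualTranspose_faithful {φ ψ : M →ₗ[A] N} (h : dualTranspose R E φ = dualTranspose R E ψ) :
    φ = ψ :=
  LinearMap.ext fun x => hE.ext_eval fun f => LinearMap.congr_fun (LinearMap.congr_fun h f) x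

end

lemma dual_self_injective : Module.Injective Aᵐᵒᵖ (A →ₗ[R] E) := by
  have := hE.injective
  refine injective_of_coinduced (R := R) (E := E) (LinearMap.applyₗ 1)
    (fun f hf => LinearMap.ext fun a => ?_)
    fun φ => ⟨φ ∘ₗ (opLinearEquiv R).toLinearMap, fun a => congrArg φ (congrArg op (mul_one _))⟩
  exact (congrArg f (mul_one a)).symm.trans (hf (op a))

variable (M : Type u) [AddCommGroup M] [Module A M] [Module R M] [IsScalarTower R A M]
  [Module.Finite A M]

lemma dual_injective [Module.Projective A M] :
    Module.Injective Aᵐᵒᵖ (M →ₗ[R] E) := by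
  classical
  obtain ⟨n, π, hπ⟩ := Module.Finite.exists_fin' A M
  obtain ⟨σ, hσ⟩ := Module.projective_lifting_property π LinearMap.id hπ
  have := hE.dual_self_injective (A := A)
  let s : (M →ₗ[R] E) →ₗ[Aᵐᵒᵖ] (Fin n → (A →ₗ[R] E)) :=
    LinearMap.pi fun i => dualTranspose R E (π ∘ₗ LinearMap.single A (fun _ => A) i)
  let r : (Fin n → (A →ₗ[R] E)) →ₗ[Aᵐᵒᵖ] (M →ₗ[R] E) :=
    ∑ i, dualTranspose R E (LinearMap.proj i ∘ₗ σ) ∘ₗ LinearMap.proj i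
  refine injective_of_retract (s := s) (r := r) (LinearMap.ext fun f => LinearMap.ext fun x => ?_)
  calc r (s f) x = ∑ i, f (π (Pi.single i (σ x i))) := by
        simp only [r, LinearMap.sum_apply]
        rfl
    _ = f (π (σ x)) := by rw [← map_sum, ← map_sum, Finset.univ_sum_single]
    _ = f x := congrArg f (LinearMap.congr_fun hσ x)

variable [Module.Finite R A]

lemma projective_of_dual_injective [Module.Injective Aᵐᵒᵖ (M →ₗ[R] E)] :
    Module.Projective A M := by
  obtain ⟨n, π, hπ⟩ := Module.Finite.exists_fin' A M
  obtain ⟨s, hs⟩ := exists_retraction_of_injective (dualTranspose_injective (R := R) (E := E) hπ)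
  obtain ⟨σ, rfl⟩ := hE.exists_dualTranspose_eq s
  exact Module.Projective.of_split σ π (hE.dualTranspose_faithful hs)

lemma hasInjectiveDimensionLT_dual_iff [IsNoetherianRing A] (n : ℕ) :
    HasInjectiveDimensionLT (ModuleCat.of Aᵐᵒᵖ (M →ₗ[R] E)) (n + 1) ↔
      HasProjectiveDimensionLT (ModuleCat.of A M) (n + 1) := by
  induction n generalizing M with
  | zero =>
    rw [zero_add, hasProjectiveDimensionLT_one_iff_projective,
      hasInjectiveDimensionLT_one_iff_injective]
    exact ⟨fun _ => hE.projective_of_dual_injective M, fun _ => hE.dual_injective M⟩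
  | succ n ih =>
    obtain ⟨k, π, hπ⟩ := Module.Finite.exists_fin' A M
    have hker := LinearMap.exact_subtype_ker_map π
    have hsub := (LinearMap.ker π).subtype_injective
    have := hE.injective
    have := hE.dual_injective (A := A) (Fin k → A)
    rw [hasProjectiveDimensionLT_right_iff_of_projective hsub hker hπ,
      hasInjectiveDimensionLT_left_iff_of_injective (dualTranspose_injective hπ)
        (dualTranspose_exact hker hπ) (dualTranspose_surjective hsub), ih]

lemma finiteInjDim_dual_iff [IsNoetherianRing A] :
    FiniteInjDim Aᵐᵒᵖ (M →ₗ[R] E) ↔ FiniteProjDim A M := by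
  rw [finiteInjDim_iff, finiteProjDim_iff]
  exact exists_congr (hE.hasInjectiveDimensionLT_dual_iff M)

omit [Module.Finite A M] in
variable (A) in
/-- The evaluation isomorphism of the right module `A` with its double dual. -/
noncomputable def bidualEquiv : A ≃ₗ[Aᵐᵒᵖ] ((A →ₗ[R] E) →ₗ[R] E) :=
  .ofBijective
    { toFun := LinearMap.applyₗ (R := R)
      map_add' := map_add _
      map_smul' := fun _ _ => rfl }
    (hE.bijective_eval A)

end IsMatlisModule

end ArtinDuality

section ArtinAlgebra

attribute [local instance] regularDualModule dualModule isScalarTower_regularDual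

lemma IsMatlisModule.finite_regularDual {R A E : Type u} [CommRing R] [Ring A] [Algebra R A]
    [Module.Finite R A] [AddCommGroup E] [Module R E] (hE : IsMatlisModule R E) :
    Module.Finite A (A →ₗ[R] E) :=
  have := hE.finite_hom A
  Module.Finite.of_restrictScalars_finite R A (A →ₗ[R] E)

lemma exists_injective_linearMap_pi_regularDual {R A E M : Type u} [CommRing R] [Ring A]
    [Algebra R A] [IsArtinianRing A] [AddCommGroup E] [Module R E] (hE : IsMatlisModule R E)
    [AddCommGroup M] [Module A M] [Module.Finite A M] :
    ∃ (n : ℕ) (f : M →ₗ[A] (Fin n → (A →ₗ[R] E))), Function.Injective f := by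
  let : Module R M := Module.compHom M (algebraMap R A)
  have : IsScalarTower R A M := IsScalarTower.of_compHom R A M
  refine exists_injective_linearMap_pi fun x hx => ?_
  obtain ⟨f, hf⟩ := hE.exists_ne_zero M x hx
  exact ⟨coinducedLift f, fun h => hf <|
    (coinducedLift_apply_one (A := A) f x).symm.trans (LinearMap.congr_fun h 1)⟩

variable {A : Type u} [Ring A] [IsArtinAlgebra A]

instance isArtinianRing_of_isArtinAlgebra : IsArtinianRing A := by
  obtain ⟨R, _, _, _, _⟩ := IsArtinAlgebra.exists_base (A := A)
  exact isArtinian_of_tower R inferInstance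

lemma exists_finite_injective_embedding (M : Type u) [AddCommGroup M] [Module A M]
    [Module.Finite A M] :
    ∃ (J : Type u) (_ : AddCommGroup J) (_ : Module A J) (f : M →ₗ[A] J),
      Module.Finite A J ∧ Module.Injective A J ∧ Function.Injective f := by
  obtain ⟨R, _, _, _, _⟩ := IsArtinAlgebra.exists_base (A := A)
  obtain ⟨E, _, _, hE⟩ := exists_isMatlisModule R
  have := hE.injective
  have := hE.finite_regularDual (A := A)
  have : Module.Injective A (A →ₗ[R] E) := regularDual_injective
  obtain ⟨n, f, hf⟩ := exists_injective_linearMap_pi_regularDual (A := A) (M := M) hE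
  exact ⟨_, inferInstance, inferInstance, f, inferInstance, inferInstance, hf⟩

theorem finiteInjDim_op_iff : FiniteInjDim Aᵐᵒᵖ A ↔
    ∀ (J : Type u) [AddCommGroup J] [Module A J] [Module.Finite A J] [Module.Injective A J],
      FiniteProjDim A J := by
  obtain ⟨R, _, _, _, _⟩ := IsArtinAlgebra.exists_base (A := A)
  obtain ⟨E, _, _, hE⟩ := exists_isMatlisModule R
  have := hE.injective
  have := hE.finite_regularDual (A := A)
  have : Module.Injective A (A →ₗ[R] E) := regularDual_injective
  have hdual : FiniteInjDim Aᵐᵒᵖ A ↔ FiniteProjDim A (A →ₗ[R] E) :=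
    Iff.trans ⟨fun h => h.congr (hE.bidualEquiv A).symm, fun h => h.congr (hE.bidualEquiv A)⟩
      (hE.finiteInjDim_dual_iff (A →ₗ[R] E))
  refine hdual.trans ⟨fun h J _ _ _ _ => ?_, fun h => h _⟩
  obtain ⟨n, f, hf⟩ := exists_injective_linearMap_pi_regularDual (A := A) (M := J) hE
  obtain ⟨r, hr⟩ := exists_retraction_of_injective hf
  exact (h.pi n).of_retract hr

lemma isGorenstein_iff_finiteInjDim : IsGorenstein A ↔ FiniteInjDim A A ∧
    ∀ (J : Type u) [AddCommGroup J] [Module A J] [Module.Finite A J] [Module.Injective A J],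
      FiniteProjDim A J :=
  and_congr_right fun _ => finiteInjDim_op_iff

lemma IsGorenstein.finiteInjDim (hA : IsGorenstein A) {M : Type u} [AddCommGroup M] [Module A M]
    [Module.Finite A M] (h : FiniteProjDim A M) : FiniteInjDim A M :=
  h.finiteInjDim hA.1

lemma IsGorenstein.finiteProjDim (hA : IsGorenstein A) {M : Type u} [AddCommGroup M] [Module A M]
    [Module.Finite A M] (h : FiniteInjDim A M) : FiniteProjDim A M := by
  obtain ⟨n, hn⟩ := finiteInjDim_iff.1 h
  clear h
  induction n generalizing M with
  | zero =>
    have := hasInjectiveDimensionLT_one_iff_injective.1 hn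
    exact finiteInjDim_op_iff.1 hA.2 M
  | succ n ih =>
    obtain ⟨J, _, _, f, _, _, hf⟩ := exists_finite_injective_embedding (A := A) M
    have hexact := LinearMap.exact_map_mkQ_range f
    have hsurj := (LinearMap.range f).mkQ_surjective
    exact .of_exact_left hf hexact hsurj (finiteInjDim_op_iff.1 hA.2 J)
      (ih ((hasInjectiveDimensionLT_left_iff_of_injective hf hexact hsurj n).1 hn))

end ArtinAlgebra

section Ext

variable {A : Type u} [Ring A] {S : Type u} [AddCommGroup S] [Module A S]

section Exact

variable {M N P : Type u} [AddCommGroup M] [Module A M] [AddCommGroup N] [Module A N]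
  [AddCommGroup P] [Module A P] {f : M →ₗ[A] N} {g : N →ₗ[A] P} (hf : Function.Injective f)
  (hfg : Function.Exact f g) (hg : Function.Surjective g)

include hf hfg hg

lemma subsingleton_ext_of_exact_middle {n : ℕ}
    (h₁ : Subsingleton (Ext (ModuleCat.of A S) (ModuleCat.of A M) n))
    (h₃ : Subsingleton (Ext (ModuleCat.of A S) (ModuleCat.of A P) n)) :
    Subsingleton (Ext (ModuleCat.of A S) (ModuleCat.of A N) n) := by
  obtain ⟨_, hE⟩ := exists_shortExact hf hfg hg
  refine subsingleton_of_forall_eq 0 fun x => ?_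
  obtain ⟨y, rfl⟩ := Ext.covariant_sequence_exact₂ _ hE x (h₃.elim _ _)
  rw [h₁.elim y 0, Ext.zero_comp]

lemma subsingleton_ext_of_exact_right {n : ℕ}
    (h₂ : Subsingleton (Ext (ModuleCat.of A S) (ModuleCat.of A N) n))
    (h₁ : Subsingleton (Ext (ModuleCat.of A S) (ModuleCat.of A M) (n + 1))) :
    Subsingleton (Ext (ModuleCat.of A S) (ModuleCat.of A P) n) := by
  obtain ⟨_, hE⟩ := exists_shortExact hf hfg hg
  refine subsingleton_of_forall_eq 0 fun x => ?_
  obtain ⟨y, rfl⟩ := Ext.covariant_sequence_exact₃ _ hE x rfl (h₁.elim _ _)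
  rw [h₂.elim y 0, Ext.zero_comp]

lemma exists_comp_eq_of_subsingleton_ext
    (h₁ : Subsingleton (Ext (ModuleCat.of A S) (ModuleCat.of A M) 1)) (t : S →ₗ[A] P) :
    ∃ t' : S →ₗ[A] N, g ∘ₗ t' = t := by
  obtain ⟨_, hE⟩ := exists_shortExact hf hfg hg
  obtain ⟨y, hy⟩ := Ext.covariant_sequence_exact₃ _ hE (Ext.mk₀ (ModuleCat.ofHom t)) rfl
    (h₁.elim _ _)
  obtain ⟨t', rfl⟩ := (Ext.mk₀_bijective _ _).2 y
  rw [Ext.mk₀_comp_mk₀] at hy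
  exact ⟨t'.hom, congrArg ModuleCat.Hom.hom ((Ext.mk₀_bijective _ _).1 hy)⟩

end Exact

lemma subsingleton_ext_pi {M : Type u} [AddCommGroup M] [Module A M] {k : ℕ}
    (h : Subsingleton (Ext (ModuleCat.of A S) (ModuleCat.of A M) k)) (n : ℕ) :
    Subsingleton (Ext (ModuleCat.of A S) (ModuleCat.of A (Fin n → M)) k) := by
  induction n with
  | zero =>
    refine subsingleton_of_forall_eq 0 fun x => ?_
    rw [← x.comp_mk₀_id, (ModuleCat.isZero_of_subsingleton _).eq_zero_of_src (𝟙 _), Ext.mk₀_zero,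
      Ext.comp_zero]
  | succ n ih =>
    exact subsingleton_ext_of_exact_middle (Pi.single_injective (M := fun _ => M) 0)
      (exact_single_funLeft_succ n)
      (LinearMap.funLeft_surjective_of_injective A M _ (Fin.succ_injective n)) h ih

lemma IsLocalizable.hasProjectiveDimensionLT (A S : Type u) [Ring A] [AddCommGroup S] [Module A S]
    [hS : IsLocalizable A S] : HasProjectiveDimensionLT (ModuleCat.of A S) 2 :=
  (projectiveDimension_le_iff _ 1).1 hS.projectiveDimension_le_one

lemma IsLocalizable.finiteProjDim (A S : Type u) [Ring A] [AddCommGroup S] [Module A S]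
    [IsLocalizable A S] : FiniteProjDim A S :=
  finiteProjDim_iff.2 ⟨1, IsLocalizable.hasProjectiveDimensionLT A S⟩

lemma IsLocalizable.subsingleton_ext_two (A S : Type u) [Ring A] [AddCommGroup S] [Module A S]
    [IsLocalizable A S] (X : ModuleCat.{u} A) : Subsingleton (Ext (ModuleCat.of A S) X 2) :=
  have := IsLocalizable.hasProjectiveDimensionLT A S
  HasProjectiveDimensionLT.subsingleton _ 2 2 le_rfl X

end Ext

section Perp

variable (A : Type u) [Ring A] (S : Type u) [AddCommGroup S] [Module A S]

/-- The module `Y` is right perpendicular to `S`: the condition defining `PerpCat A S`, for a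
module that need not be finitely generated or bundled. -/
structure IsPerp (Y : Type u) [AddCommGroup Y] [Module A Y] : Prop where
  hom_eq_zero : ∀ f : S →ₗ[A] Y, f = 0
  subsingleton_ext : Subsingleton (Ext (ModuleCat.of A S) (ModuleCat.of A Y) 1)

variable {A S} {X Y Z : Type u} [AddCommGroup X] [Module A X] [AddCommGroup Y] [Module A Y]
  [AddCommGroup Z] [Module A Z]

lemma PerpCat.isPerp (Y : PerpCat A S) : IsPerp A S Y.obj :=
  ⟨fun _ => Y.property.1.elim _ _, Y.property.2⟩

/-- A finitely generated module perpendicular to `S`, as an object of `S^⊥`. -/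
abbrev IsPerp.perpCat [Module.Finite A Y] (hY : IsPerp A S Y) : PerpCat A S :=
  ⟨FGModuleCat.of A Y, subsingleton_of_forall_eq 0 hY.hom_eq_zero, hY.subsingleton_ext⟩

lemma isPerp_of_exact_right [IsLocalizable A S] {f : X →ₗ[A] Y} {g : Y →ₗ[A] Z}
    (hf : Function.Injective f) (hfg : Function.Exact f g) (hg : Function.Surjective g)
    (hX : Subsingleton (Ext (ModuleCat.of A S) (ModuleCat.of A X) 1))
    (hY : Subsingleton (Ext (ModuleCat.of A S) (ModuleCat.of A Y) 1))
    (hcomp : ∀ t : S →ₗ[A] Y, g ∘ₗ t = 0) : IsPerp A S Z where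
  hom_eq_zero t := by
    obtain ⟨t', rfl⟩ := exists_comp_eq_of_subsingleton_ext hf hfg hg hX t
    exact hcomp t'
  subsingleton_ext :=
    subsingleton_ext_of_exact_right hf hfg hg hY (IsLocalizable.subsingleton_ext_two A S _)

lemma IsPerp.of_exact [IsLocalizable A S] (hX : IsPerp A S X) (hY : IsPerp A S Y)
    {f : X →ₗ[A] Y} {g : Y →ₗ[A] Z} (hfg : Function.Exact f g) (hg : Function.Surjective g) :
    IsPerp A S Z := by
  have hrange : Subsingleton (Ext (ModuleCat.of A S) (ModuleCat.of A (LinearMap.range f)) 1) :=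
    subsingleton_ext_of_exact_right (Submodule.subtype_injective _)
      (exact_subtype_rangeRestrict f) f.surjective_rangeRestrict hX.subsingleton_ext
      (IsLocalizable.subsingleton_ext_two A S _)
  have hexact : Function.Exact (LinearMap.range f).subtype g := by
    rwa [LinearMap.exact_iff, Submodule.range_subtype, ← LinearMap.exact_iff]
  refine isPerp_of_exact_right (Submodule.subtype_injective _) hexact hg hrange
    hY.subsingleton_ext fun t => ?_
  rw [hY.hom_eq_zero t, LinearMap.comp_zero]

lemma IsPerp.pi (hX : IsPerp A S X) (n : ℕ) : IsPerp A S (Fin n → X) where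
  hom_eq_zero f := LinearMap.ext fun s => funext fun i =>
    LinearMap.congr_fun (hX.hom_eq_zero (LinearMap.proj i ∘ₗ f)) s
  subsingleton_ext := subsingleton_ext_pi hX.subsingleton_ext n

end Perp

section IsotypicComponent

variable {A : Type*} [Ring A] {S : Type*} [AddCommGroup S] [Module A S]
  {X Y : Type*} [AddCommGroup X] [Module A X] [AddCommGroup Y] [Module A Y]

lemma isotypicComponent_le_ker (hY : ∀ f : S →ₗ[A] Y, f = 0) (f : X →ₗ[A] Y) :
    isotypicComponent A X S ≤ LinearMap.ker f :=
  sSup_le fun m ⟨e⟩ x hx =>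
    (congrArg (fun y : m => f y) (e.symm_apply_apply ⟨x, hx⟩)).symm.trans
      (LinearMap.congr_fun (hY (f ∘ₗ m.subtype ∘ₗ e.symm.toLinearMap)) (e ⟨x, hx⟩))

variable [IsSimpleModule A S]

lemma apply_mem_isotypicComponent (g : S →ₗ[A] X) (s : S) : g s ∈ isotypicComponent A X S := by
  have htop : isotypicComponent A S S = ⊤ := top_le_iff.1 (le_sSup ⟨Submodule.topEquiv⟩)
  exact LinearMap.le_comap_isotypicComponent S g (htop ▸ Submodule.mem_top)

lemma exists_isotypicComponent_equiv [IsNoetherian A X] :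
    ∃ n, Nonempty (isotypicComponent A X S ≃ₗ[A] (Fin n → S)) :=
  (IsIsotypicOfType.isotypicComponent A X S).linearEquiv_fun

lemma comap_isotypicComponent_le {j : X →ₗ[A] Y} (hj : Function.Injective j) :
    (isotypicComponent A Y S).comap j ≤ isotypicComponent A X S := by
  let N := (isotypicComponent A Y S).comap j
  let k : N →ₗ[A] isotypicComponent A Y S := j.restrict fun x hx => hx
  have hinj : Function.Injective k :=
    fun x y h => Subtype.ext (hj (congrArg Subtype.val h))
  have := IsSemisimpleModule.of_injective k hinj
  have hN : IsIsotypicOfType A N S :=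
    (IsIsotypicOfType.isotypicComponent A Y S).of_injective k hinj
  have htop : isotypicComponent A N S = ⊤ := top_le_iff.1 <|
    (IsSemisimpleModule.sSup_simples_eq_top A N).symm.trans_le
      (sSup_le_sSup fun m (_ : IsSimpleModule A m) => hN m)
  intro x hx
  exact LinearMap.le_comap_isotypicComponent S N.subtype
    (htop ▸ Submodule.mem_top : (⟨x, hx⟩ : N) ∈ isotypicComponent A N S)

end IsotypicComponent

section RetractionModules

variable {A : Type u} [Ring A] [IsArtinAlgebra A]
  {S : Type u} [AddCommGroup S] [Module A S] [IsLocalizable A S]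

instance (Y : PerpCat A S) : IsScalarTower A (RetractionAlgebra A S) Y.obj :=
  ⟨fun a x y => map_smul (extendRightMul Y y) a x⟩

instance : IsScalarTower A (RetractionAlgebra A S) (RetractionAlgebra A S) :=
  inferInstanceAs (IsScalarTower A (RetractionAlgebra A S) (perpA A S).obj)

instance : Module.Finite A (RetractionAlgebra A S) :=
  inferInstanceAs (Module.Finite A (perpA A S).obj)

lemma RetractionAlgebra.isPerp : IsPerp A S (RetractionAlgebra A S) :=
  (perpA A S).isPerp

lemma leftRetraction_mul (a : A) (x : RetractionAlgebra A S) : leftRetraction A S a * x = a • x :=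
  leftRetraction_smul (perpA A S) a x

lemma commute_leftRetraction {z : A} (hz : ∀ a, Commute z a) (x : RetractionAlgebra A S) :
    Commute (leftRetraction A S z) x := by
  let zsmul : RetractionAlgebra A S →ₗ[A] RetractionAlgebra A S :=
    { toFun := (z • ·)
      map_add' := smul_add z
      map_smul' := fun a x => by rw [← mul_smul, (hz a).eq, mul_smul, RingHom.id_apply] }
  have heq : zsmul = starRight (leftRetraction A S z) := retraction_end_ext fun a => by
    rw [starRight_eta]
    change z • etaLinear A S a = a • etaLinear A S z
    rw [← map_smul, ← map_smul, smul_eq_mul, smul_eq_mul, (hz a).eq]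
  exact (leftRetraction_mul z x).trans (LinearMap.congr_fun heq x)

variable (A S) in
instance RetractionAlgebra.isArtinAlgebra : IsArtinAlgebra (RetractionAlgebra A S) := by
  obtain ⟨R, _, _, _, _⟩ := IsArtinAlgebra.exists_base (A := A)
  let : Algebra R (RetractionAlgebra A S) :=
    ((leftRetraction A S).comp (algebraMap R A)).toAlgebra' fun r =>
      commute_leftRetraction (Algebra.commutes r)
  have : IsScalarTower R A (RetractionAlgebra A S) := ⟨fun r a x => by
    rw [Algebra.smul_def, mul_smul, ← leftRetraction_mul, Algebra.smul_def]
    rfl⟩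
  exact ⟨R, inferInstance, inferInstance, inferInstance, Module.Finite.trans A _⟩

lemma exists_restriction (Y : Type u) [AddCommGroup Y] [Module (RetractionAlgebra A S) Y] :
    ∃ _ : Module A Y, IsScalarTower A (RetractionAlgebra A S) Y := by
  let : Module A Y := Module.compHom Y (leftRetraction A S)
  refine ⟨inferInstance, ⟨fun a x y => ?_⟩⟩
  rw [← leftRetraction_mul, mul_smul]
  rfl

lemma isPerp_of_finite (Y : Type u) [AddCommGroup Y] [Module A Y]
    [Module (RetractionAlgebra A S) Y] [IsScalarTower A (RetractionAlgebra A S) Y]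
    [Module.Finite (RetractionAlgebra A S) Y] : IsPerp A S Y := by
  obtain ⟨n, π, hπ⟩ := Module.Finite.exists_fin' (RetractionAlgebra A S) Y
  obtain ⟨m, σ, hσ⟩ := Module.Finite.exists_fin' (RetractionAlgebra A S) (LinearMap.ker π)
  have hexact : Function.Exact ((LinearMap.ker π).subtype ∘ₗ σ) π := by
    rw [LinearMap.exact_iff, LinearMap.range_comp_of_range_eq_top _ (LinearMap.range_eq_top.2 hσ),
      Submodule.range_subtype]
  exact (RetractionAlgebra.isPerp.pi m).of_exact (RetractionAlgebra.isPerp.pi n)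
    (f := ((LinearMap.ker π).subtype ∘ₗ σ).restrictScalars A) (g := π.restrictScalars A) hexact hπ

lemma PerpCat.exists_module (Y : PerpCat A S) :
    ∃ _ : Module (RetractionAlgebra A S) Y.obj, IsScalarTower A (RetractionAlgebra A S) Y.obj ∧
      Module.Finite (RetractionAlgebra A S) Y.obj :=
  ⟨inferInstance, inferInstance,
    Module.Finite.of_restrictScalars_finite A (RetractionAlgebra A S) Y.obj⟩

section

variable {Y : Type u} [AddCommGroup Y] [Module A Y] [Module.Finite A Y]

lemma IsPerp.exists_module (hY : IsPerp A S Y) :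
    ∃ _ : Module (RetractionAlgebra A S) Y, IsScalarTower A (RetractionAlgebra A S) Y ∧
      Module.Finite (RetractionAlgebra A S) Y :=
  hY.perpCat.exists_module

lemma IsPerp.retraction_hom_ext (hY : IsPerp A S Y) {f g : RetractionAlgebra A S →ₗ[A] Y}
    (h : ∀ a, f (etaLinear A S a) = g (etaLinear A S a)) : f = g :=
  _root_.retraction_hom_ext (Y := hY.perpCat) h

end

section

variable {Y Z : Type u} [AddCommGroup Y] [Module A Y] [Module (RetractionAlgebra A S) Y]
  [IsScalarTower A (RetractionAlgebra A S) Y] [AddCommGroup Z] [Module A Z]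
  [Module (RetractionAlgebra A S) Z] [IsScalarTower A (RetractionAlgebra A S) Z]
  [Module.Finite (RetractionAlgebra A S) Z]

lemma map_retraction_smul (f : Y →ₗ[A] Z) (x : RetractionAlgebra A S) (y : Y) :
    f (x • y) = x • f y := by
  have : Module.Finite A Z := Module.Finite.trans (RetractionAlgebra A S) Z
  have heq : f ∘ₗ (LinearMap.toSpanSingleton (RetractionAlgebra A S) Y y).restrictScalars A =
      (LinearMap.toSpanSingleton (RetractionAlgebra A S) Z (f y)).restrictScalars A := by
    refine (isPerp_of_finite (S := S) Z).retraction_hom_ext fun a => ?_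
    have hη : etaLinear A S a = a • (1 : RetractionAlgebra A S) :=
      (map_one (leftRetraction A S) ▸ mul_one (leftRetraction A S a)).symm.trans
        (leftRetraction_mul a 1)
    simp only [hη, LinearMap.comp_apply, LinearMap.restrictScalars_apply,
      LinearMap.toSpanSingleton_apply, one_smul, map_smul]
  exact LinearMap.congr_fun heq x

variable (S) in
/-- An `A`-linear map between `L(A)`-modules, as an `L(A)`-linear map: restriction along `η_A` is
fully faithful. -/
def extendScalarsRetraction (f : Y →ₗ[A] Z) : Y →ₗ[RetractionAlgebra A S] Z where
  toFun := f
  map_add' := map_add f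
  map_smul' := map_retraction_smul f

end

end RetractionModules

section IsReflection

variable {A : Type u} [Ring A] {S : Type u} [AddCommGroup S] [Module A S]

variable (A S) in
/-- The map `η : X → Y` is a reflection of `X` in `S^⊥`: it has the universal property of the unit
`X → L(X)` of the adjunction, here required of modules rather than of objects of `PerpCat A S`. -/
structure IsReflection {X Y : Type u} [AddCommGroup X] [Module A X] [AddCommGroup Y] [Module A Y]
    (η : X →ₗ[A] Y) : Prop where
  isPerp : IsPerp A S Y
  finite : Module.Finite A Y
  existsUnique : ∀ (Z : Type u) [AddCommGroup Z] [Module A Z] [Module.Finite A Z],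
    IsPerp A S Z → ∀ f : X →ₗ[A] Z, ∃! g : Y →ₗ[A] Z, g ∘ₗ η = f

namespace IsReflection

variable {X Y X' Y' X'' Y'' : Type u} [AddCommGroup X] [Module A X] [AddCommGroup Y] [Module A Y]
  [AddCommGroup X'] [Module A X'] [AddCommGroup Y'] [Module A Y']
  [AddCommGroup X''] [Module A X''] [AddCommGroup Y''] [Module A Y'']
  {η : X →ₗ[A] Y} {η' : X' →ₗ[A] Y'} {η'' : X'' →ₗ[A] Y''}

lemma hom_ext (h : IsReflection A S η) {Z : Type u} [AddCommGroup Z] [Module A Z]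
    [Module.Finite A Z] (hZ : IsPerp A S Z) {f g : Y →ₗ[A] Z} (hfg : ∀ x, f (η x) = g (η x)) :
    f = g :=
  (h.existsUnique Z hZ (g ∘ₗ η)).unique (LinearMap.ext hfg) rfl

lemma exists_extension (h : IsReflection A S η) {Z : Type u} [AddCommGroup Z] [Module A Z]
    [Module.Finite A Z] (hZ : IsPerp A S Z) (f : X →ₗ[A] Z) :
    ∃ g : Y →ₗ[A] Z, ∀ x, g (η x) = f x := by
  obtain ⟨g, hg, -⟩ := h.existsUnique Z hZ f
  exact ⟨g, LinearMap.congr_fun hg⟩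

lemma exists_map (h : IsReflection A S η) (h' : IsReflection A S η') (f : X →ₗ[A] X') :
    ∃ g : Y →ₗ[A] Y', ∀ x, g (η x) = η' (f x) :=
  have := h'.finite
  h.exists_extension h'.isPerp (η' ∘ₗ f)

section RightExact

variable [IsLocalizable A S]

lemma surjective_map (h : IsReflection A S η) (h' : IsReflection A S η') {f : X →ₗ[A] X'}
    (hf : Function.Surjective f) {g : Y →ₗ[A] Y'} (hg : ∀ x, g (η x) = η' (f x)) :
    Function.Surjective g := by
  have := h'.finite
  have hcoker : IsPerp A S (Y' ⧸ LinearMap.range g) :=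
    h.isPerp.of_exact h'.isPerp (LinearMap.exact_map_mkQ_range g) (Submodule.mkQ_surjective _)
  have hzero : (LinearMap.range g).mkQ = 0 := h'.hom_ext hcoker fun x => by
    obtain ⟨x, rfl⟩ := hf x
    exact (Submodule.Quotient.mk_eq_zero _).2 ⟨η x, hg x⟩
  exact fun y => (Submodule.Quotient.mk_eq_zero _).1 (LinearMap.congr_fun hzero y)

lemma exact_map (h : IsReflection A S η) (h' : IsReflection A S η') (h'' : IsReflection A S η'')
    {f : X →ₗ[A] X'} {g : X' →ₗ[A] X''} (hfg : Function.Exact f g) (hg : Function.Surjective g)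
    {f' : Y →ₗ[A] Y'} {g' : Y' →ₗ[A] Y''} (hf' : ∀ x, f' (η x) = η' (f x))
    (hg' : ∀ x, g' (η' x) = η'' (g x)) : Function.Exact f' g' := by
  have := h'.finite
  have := h''.finite
  have hcomp : g' ∘ₗ f' = 0 := h.hom_ext h''.isPerp fun x => by
    rw [LinearMap.comp_apply, hf', hg', hfg.apply_apply_eq_zero, map_zero, LinearMap.zero_apply]
  have hcoker : IsPerp A S (Y' ⧸ LinearMap.range f') :=
    h.isPerp.of_exact h'.isPerp (LinearMap.exact_map_mkQ_range f') (Submodule.mkQ_surjective _)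
  obtain ⟨v, hv⟩ := exists_comp_eq_of_ker_le hg (d := (LinearMap.range f').mkQ ∘ₗ η')
    fun x hx => by
      obtain ⟨y, rfl⟩ := (hfg x).1 hx
      exact (Submodule.Quotient.mk_eq_zero _).2 ⟨η y, hf' y⟩
  obtain ⟨w, hw⟩ := h''.exists_extension hcoker v
  have hwg : w ∘ₗ g' = (LinearMap.range f').mkQ := h'.hom_ext hcoker fun x => by
    rw [LinearMap.comp_apply, hg', hw]
    exact LinearMap.congr_fun hv x
  refine LinearMap.exact_iff.2 (le_antisymm ?_ (LinearMap.range_le_ker_iff.2 hcomp))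
  calc LinearMap.ker g' ≤ LinearMap.ker (w ∘ₗ g') := LinearMap.ker_le_ker_comp g' w
    _ = LinearMap.range f' := by rw [hwg, Submodule.ker_mkQ]

end RightExact

end IsReflection

end IsReflection

section Reflection

variable {A : Type u} [Ring A] [IsArtinAlgebra A]
  {S : Type u} [AddCommGroup S] [Module A S] [IsLocalizable A S]

lemma isPerp_quotient_isotypicComponent (J : Type u) [AddCommGroup J] [Module A J]
    [Module.Finite A J] [Module.Injective A J] : IsPerp A S (J ⧸ isotypicComponent A J S) := by
  have := IsLocalizable.isSimple (A := A) (S := S)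
  obtain ⟨n, ⟨e⟩⟩ := exists_isotypicComponent_equiv (A := A) (S := S) (X := J)
  have hexact : Function.Exact ((isotypicComponent A J S).subtype ∘ₗ e.symm.toLinearMap)
      (isotypicComponent A J S).mkQ := by
    rw [LinearMap.exact_iff, Submodule.ker_mkQ, LinearEquiv.range_comp, Submodule.range_subtype]
  have : Injective (ModuleCat.of A J) := (Module.injective_iff_injective_object A J).1 inferInstance
  have hinj : Function.Injective ((isotypicComponent A J S).subtype ∘ₗ e.symm.toLinearMap) :=
    (Submodule.subtype_injective _).comp e.symm.injective
  refine isPerp_of_exact_right hinj hexact (Submodule.mkQ_surjective _)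
    (subsingleton_ext_pi IsLocalizable.subsingleton_ext_one n) (Ext.subsingleton_of_injective _ _ 0)
    fun t => LinearMap.ext fun s => ?_
  exact (Submodule.Quotient.mk_eq_zero _).2 (apply_mem_isotypicComponent t s)

variable (A S) in
lemma exists_isPerp_ker_le_isotypicComponent (X : Type u) [AddCommGroup X] [Module A X]
    [Module.Finite A X] :
    ∃ (Z : Type u) (_ : AddCommGroup Z) (_ : Module A Z) (f : X →ₗ[A] Z), Module.Finite A Z ∧
      IsPerp A S Z ∧ LinearMap.ker f ≤ isotypicComponent A X S := by
  have := IsLocalizable.isSimple (A := A) (S := S)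
  obtain ⟨J, _, _, j, _, _, hj⟩ := exists_finite_injective_embedding (A := A) X
  refine ⟨_, _, _, (isotypicComponent A J S).mkQ ∘ₗ j, inferInstance,
    isPerp_quotient_isotypicComponent J, ?_⟩
  rw [LinearMap.ker_comp, Submodule.ker_mkQ]
  exact comap_isotypicComponent_le hj

lemma isReflection_perpUnit (X : FGModuleCat.{u} A) :
    IsReflection A S ((perpUnit A S).app X).hom.hom where
  isPerp := ((iLambda A S).obj X).isPerp
  finite := inferInstanceAs (Module.Finite A ((perpL A S).obj X))
  existsUnique Z _ _ _ hZ f := by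
    have homEquiv_apply (g : (iLambda A S).obj X ⟶ hZ.perpCat) :
        ((perpAdj A S).homEquiv X hZ.perpCat g).hom.hom =
          g.hom.hom.hom ∘ₗ ((perpUnit A S).app X).hom.hom := by
      rw [Adjunction.homEquiv_unit]
      rfl
    let f' : X ⟶ (perpInclusion A S).obj hZ.perpCat := ObjectProperty.homMk (ModuleCat.ofHom f)
    refine ⟨(((perpAdj A S).homEquiv X hZ.perpCat).symm f').hom.hom.hom, ?_, fun g hg => ?_⟩
    · change _ ∘ₗ _ = _
      rw [← homEquiv_apply, Equiv.apply_symm_apply]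
      rfl
    · let g' : (iLambda A S).obj X ⟶ hZ.perpCat :=
        ObjectProperty.homMk (ObjectProperty.homMk (ModuleCat.ofHom g))
      have hg' : (perpAdj A S).homEquiv X hZ.perpCat g' = f' :=
        FGModuleCat.hom_ext ((homEquiv_apply g').trans hg)
      rw [← hg', Equiv.symm_apply_apply]
      rfl

variable (A S) in
lemma isReflection_etaLinear : IsReflection A S (etaLinear A S) :=
  isReflection_perpUnit (FGModuleCat.of A A)

variable (A S) in
lemma exists_isReflection (X : Type u) [AddCommGroup X] [Module A X] [Module.Finite A X] :
    ∃ (Y : Type u) (_ : AddCommGroup Y) (_ : Module A Y) (_ : Module (RetractionAlgebra A S) Y)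
      (_ : IsScalarTower A (RetractionAlgebra A S) Y)
      (_ : Module.Finite (RetractionAlgebra A S) Y) (η : X →ₗ[A] Y), IsReflection A S η := by
  have h := isReflection_perpUnit (S := S) (FGModuleCat.of A X)
  have := h.finite
  obtain ⟨_, _, _⟩ := h.isPerp.exists_module
  exact ⟨_, _, _, _, inferInstance, inferInstance, _, h⟩

lemma isReflection_id (Y : Type u) [AddCommGroup Y] [Module A Y] [Module (RetractionAlgebra A S) Y]
    [IsScalarTower A (RetractionAlgebra A S) Y] [Module.Finite (RetractionAlgebra A S) Y] :
    IsReflection A S (LinearMap.id : Y →ₗ[A] Y) where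
  isPerp := isPerp_of_finite Y
  finite := Module.Finite.trans (RetractionAlgebra A S) Y
  existsUnique _ _ _ _ _ f := ⟨f, rfl, fun _ hg => hg⟩

namespace IsReflection

variable {X Y X' Y' : Type u} [AddCommGroup X] [Module A X] [AddCommGroup Y] [Module A Y]
  [AddCommGroup X'] [Module A X'] [AddCommGroup Y'] [Module A Y']
  {η : X →ₗ[A] Y} {η' : X' →ₗ[A] Y'}

lemma ker_eq [Module.Finite A X] (h : IsReflection A S η) :
    LinearMap.ker η = isotypicComponent A X S := by
  refine le_antisymm ?_ (isotypicComponent_le_ker h.isPerp.hom_eq_zero η)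
  obtain ⟨Z, _, _, f, _, hZ, hf⟩ := exists_isPerp_ker_le_isotypicComponent A S X
  obtain ⟨g, hg⟩ := h.exists_extension hZ f
  refine le_trans (fun x hx => ?_) hf
  rw [LinearMap.mem_ker, ← hg, LinearMap.mem_ker.1 hx, map_zero]

lemma isotypicComponent_coker (h : IsReflection A S η) :
    isotypicComponent A (Y ⧸ LinearMap.range η) S = ⊤ := by
  have := h.finite
  obtain ⟨Z, _, _, f, _, hZ, hf⟩ :=
    exists_isPerp_ker_le_isotypicComponent A S (Y ⧸ LinearMap.range η)
  have hzero : f ∘ₗ (LinearMap.range η).mkQ = 0 := h.hom_ext hZ fun x => by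
    rw [LinearMap.comp_apply, Submodule.mkQ_apply,
      (Submodule.Quotient.mk_eq_zero _).2 (LinearMap.mem_range_self η x), map_zero,
      LinearMap.zero_apply]
  have hf₀ : f = 0 :=
    (LinearMap.cancel_right (Submodule.mkQ_surjective _)).1
      (hzero.trans (LinearMap.zero_comp _).symm)
  rwa [hf₀, LinearMap.ker_zero, top_le_iff] at hf

lemma injective_map [Module.Finite A X] [Module.Finite A X'] (h : IsReflection A S η)
    (h' : IsReflection A S η') {f : X →ₗ[A] X'} (hf : Function.Injective f) {g : Y →ₗ[A] Y'}
    (hg : ∀ x, g (η x) = η' (f x)) : Function.Injective g := by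
  have := IsLocalizable.isSimple (A := A) (S := S)
  let k : LinearMap.ker g →ₗ[A] Y ⧸ LinearMap.range η :=
    (LinearMap.range η).mkQ ∘ₗ (LinearMap.ker g).subtype
  have hk : Function.Injective k := by
    refine (injective_iff_map_eq_zero k).2 fun y hy => ?_
    obtain ⟨x, hx⟩ := (Submodule.Quotient.mk_eq_zero _).1 hy
    have hfx : f x ∈ isotypicComponent A X' S := by
      rw [← h'.ker_eq, LinearMap.mem_ker, ← hg, hx]
      exact y.2
    have hx₀ : x ∈ LinearMap.ker η := h.ker_eq ▸ comap_isotypicComponent_le hf hfx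
    exact Subtype.ext (hx.symm.trans hx₀)
  have htop : isotypicComponent A (LinearMap.ker g) S = ⊤ := by
    have hle := comap_isotypicComponent_le (S := S) hk
    rwa [h.isotypicComponent_coker, Submodule.comap_top, top_le_iff] at hle
  have hker : LinearMap.ker g ≤ ⊥ := fun y hy =>
    isotypicComponent_le_ker h.isPerp.hom_eq_zero (LinearMap.ker g).subtype
      (htop ▸ Submodule.mem_top : (⟨y, hy⟩ : LinearMap.ker g) ∈ _)
  exact LinearMap.ker_eq_bot.1 (le_bot_iff.1 hker)

lemma surjective_of_injective [Module.Finite A X] [Module.Injective A X]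
    (h : IsReflection A S η) : Function.Surjective η := by
  have := h.finite
  obtain ⟨e, he⟩ := h.exists_extension (isPerp_quotient_isotypicComponent X) (Submodule.mkQ _)
  obtain ⟨q, hq⟩ := exists_comp_eq_of_ker_le (isotypicComponent A X S).mkQ_surjective (d := η)
    (by rw [Submodule.ker_mkQ, h.ker_eq])
  have hqe : q ∘ₗ e = LinearMap.id := h.hom_ext h.isPerp fun x => by
    rw [LinearMap.comp_apply, he]
    exact LinearMap.congr_fun hq x
  have hsurj : Function.Surjective q := fun y => ⟨e y, LinearMap.congr_fun hqe y⟩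
  rw [← hq, LinearMap.coe_comp]
  exact hsurj.comp (Submodule.mkQ_surjective _)

lemma exists_ker_equiv [Module.Finite A X] (h : IsReflection A S η) :
    ∃ n, Nonempty (LinearMap.ker η ≃ₗ[A] (Fin n → S)) := by
  have := IsLocalizable.isSimple (A := A) (S := S)
  rw [h.ker_eq]
  exact exists_isotypicComponent_equiv

lemma exists_coker_equiv (h : IsReflection A S η) :
    ∃ n, Nonempty ((Y ⧸ LinearMap.range η) ≃ₗ[A] (Fin n → S)) := by
  have := IsLocalizable.isSimple (A := A) (S := S)
  have := h.finite
  obtain ⟨n, ⟨e⟩⟩ :=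
    exists_isotypicComponent_equiv (A := A) (S := S) (X := Y ⧸ LinearMap.range η)
  exact ⟨n, ⟨(LinearEquiv.ofTop _ h.isotypicComponent_coker).symm.trans e⟩⟩

lemma finiteProjDim_iff [Module.Finite A X] (h : IsReflection A S η) :
    FiniteProjDim A X ↔ FiniteProjDim A Y := by
  obtain ⟨m, ⟨e⟩⟩ := h.exists_ker_equiv
  obtain ⟨n, ⟨e'⟩⟩ := h.exists_coker_equiv
  have hS := IsLocalizable.finiteProjDim A S
  exact finiteProjDim_iff_of_ker_of_coker ((hS.pi m).congr e) ((hS.pi n).congr e')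

lemma finiteInjDim_iff [Module.Finite A X] (h : IsReflection A S η) (hS : FiniteInjDim A S) :
    FiniteInjDim A X ↔ FiniteInjDim A Y := by
  obtain ⟨m, ⟨e⟩⟩ := h.exists_ker_equiv
  obtain ⟨n, ⟨e'⟩⟩ := h.exists_coker_equiv
  exact finiteInjDim_iff_of_ker_of_coker ((hS.pi m).congr e) ((hS.pi n).congr e')

end IsReflection

end Reflection

section Comparison

variable {A : Type u} [Ring A] [IsArtinAlgebra A]
  {S : Type u} [AddCommGroup S] [Module A S] [IsLocalizable A S]

lemma IsReflection.projective {P Y : Type u} [AddCommGroup P] [Module A P] [Module.Projective A P]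
    [AddCommGroup Y] [Module A Y] [Module (RetractionAlgebra A S) Y]
    [IsScalarTower A (RetractionAlgebra A S) Y] {η : P →ₗ[A] Y} (h : IsReflection A S η) :
    Module.Projective (RetractionAlgebra A S) Y := by
  have := h.finite
  have : Module.Finite (RetractionAlgebra A S) Y := .of_restrictScalars_finite A _ _
  obtain ⟨n, π, hπ⟩ := Module.Finite.exists_fin' (RetractionAlgebra A S) Y
  obtain ⟨k, hk⟩ := Module.projective_lifting_property (π.restrictScalars A) η hπ
  obtain ⟨σ, hσ⟩ := h.exists_extension (RetractionAlgebra.isPerp.pi n) k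
  have hπσ : π.restrictScalars A ∘ₗ σ = LinearMap.id := h.hom_ext h.isPerp fun x => by
    rw [LinearMap.comp_apply, hσ]
    exact LinearMap.congr_fun hk x
  exact Module.Projective.of_split (extendScalarsRetraction S σ) π
    (LinearMap.ext fun y => LinearMap.congr_fun hπσ y)

lemma IsReflection.finiteProjDim {X Y : Type u} [AddCommGroup X] [Module A X] [Module.Finite A X]
    [AddCommGroup Y] [Module A Y] [Module (RetractionAlgebra A S) Y]
    [IsScalarTower A (RetractionAlgebra A S) Y] {η : X →ₗ[A] Y} (h : IsReflection A S η)
    (hX : FiniteProjDim A X) : FiniteProjDim (RetractionAlgebra A S) Y := by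
  refine FiniteProjDim.finite_induction (motive := fun X _ _ => ∀ (Y : Type u)
    [AddCommGroup Y] [Module A Y] [Module (RetractionAlgebra A S) Y]
    [IsScalarTower A (RetractionAlgebra A S) Y] (η : X →ₗ[A] Y), IsReflection A S η →
    FiniteProjDim (RetractionAlgebra A S) Y) ?_ ?_ X hX Y η h
  · intro P _ _ _ _ Y _ _ _ _ η h
    have := h.projective
    exact .of_projective
  · intro M _ _ _ n π hπ hker Y _ _ _ _ η h
    have := h.finite
    have : Module.Finite (RetractionAlgebra A S) Y := .of_restrictScalars_finite A _ _
    obtain ⟨Y₁, _, _, _, _, _, η₁, h₁⟩ := exists_isReflection A S (LinearMap.ker π)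
    obtain ⟨Y₂, _, _, _, _, _, η₂, h₂⟩ := exists_isReflection A S (Fin n → A)
    obtain ⟨f, hf⟩ := h₁.exists_map h₂ (LinearMap.ker π).subtype
    obtain ⟨g, hg⟩ := h₂.exists_map h π
    have := h₂.projective
    exact .of_exact_right (f := extendScalarsRetraction S f) (g := extendScalarsRetraction S g)
      (h₁.injective_map h₂ (LinearMap.ker π).subtype_injective hf)
      (h₁.exact_map h₂ h (LinearMap.exact_subtype_ker_map π) hπ hf hg)
      (h₂.surjective_map h hπ hg) (hker Y₁ η₁ h₁) .of_projective

variable (A S) in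
lemma finiteProjDim_retractionAlgebra : FiniteProjDim A (RetractionAlgebra A S) :=
  (isReflection_etaLinear A S).finiteProjDim_iff.1 .of_projective

lemma FiniteProjDim.of_retraction {Y : Type u} [AddCommGroup Y] [Module A Y]
    [Module (RetractionAlgebra A S) Y] [IsScalarTower A (RetractionAlgebra A S) Y]
    [Module.Finite (RetractionAlgebra A S) Y] (hY : FiniteProjDim (RetractionAlgebra A S) Y) :
    FiniteProjDim A Y := by
  have hL := finiteProjDim_retractionAlgebra A S
  refine FiniteProjDim.finite_induction (A := RetractionAlgebra A S) (motive := fun Y _ _ =>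
    ∀ [Module A Y] [IsScalarTower A (RetractionAlgebra A S) Y], FiniteProjDim A Y) ?_ ?_ Y hY
  · intro P _ _ _ _ _ _
    obtain ⟨n, π, hπ⟩ := Module.Finite.exists_fin' (RetractionAlgebra A S) P
    obtain ⟨s, hs⟩ := Module.projective_lifting_property π LinearMap.id hπ
    exact (hL.pi n).of_retract (s := s.restrictScalars A) (r := π.restrictScalars A)
      (LinearMap.ext fun p => LinearMap.congr_fun hs p)
  · intro Y _ _ _ n π hπ hker _ _
    exact .of_exact_right (f := (LinearMap.ker π).subtype.restrictScalars A)
      (g := π.restrictScalars A) (LinearMap.ker π).subtype_injective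
      (LinearMap.exact_subtype_ker_map π) hπ hker (hL.pi n)

variable (A S) (Y : Type u) [AddCommGroup Y] [Module A Y] [Module (RetractionAlgebra A S) Y]
  [IsScalarTower A (RetractionAlgebra A S) Y] [Module.Finite (RetractionAlgebra A S) Y]

lemma finiteProjDim_iff_retraction :
    FiniteProjDim A Y ↔ FiniteProjDim (RetractionAlgebra A S) Y :=
  have : Module.Finite A Y := .trans (RetractionAlgebra A S) Y
  ⟨(isReflection_id Y).finiteProjDim, .of_retraction⟩

lemma injective_iff_retraction :
    Module.Injective A Y ↔ Module.Injective (RetractionAlgebra A S) Y := by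
  have : Module.Finite A Y := .trans (RetractionAlgebra A S) Y
  have hA := isReflection_etaLinear A S
  constructor
  · refine fun hY => Module.Baer.injective fun K f => ?_
    obtain ⟨g, hg⟩ := hY.out (K.subtype.restrictScalars A) K.subtype_injective
      (f.restrictScalars A)
    exact ⟨extendScalarsRetraction S g, fun x hx => hg ⟨x, hx⟩⟩
  · refine fun hY => Module.Baer.injective fun K f => ?_
    obtain ⟨Z, _, _, _, _, _, η, hη⟩ := exists_isReflection A S K
    obtain ⟨f', hf'⟩ := hη.exists_extension (isPerp_of_finite (S := S) Y) f
    obtain ⟨j, hj⟩ := hη.exists_map hA K.subtype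
    obtain ⟨g, hg⟩ := hY.out (extendScalarsRetraction S j)
      (hη.injective_map hA K.subtype_injective hj) (extendScalarsRetraction S f')
    refine ⟨g.restrictScalars A ∘ₗ etaLinear A S, fun x hx => ?_⟩
    calc g (etaLinear A S x) = g (j (η ⟨x, hx⟩)) := congrArg g (hj ⟨x, hx⟩).symm
      _ = f' (η ⟨x, hx⟩) := hg (η ⟨x, hx⟩)
      _ = f ⟨x, hx⟩ := hf' ⟨x, hx⟩

lemma hasInjectiveDimensionLT_iff_retraction (n : ℕ) :
    HasInjectiveDimensionLT (ModuleCat.of A Y) (n + 1) ↔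
      HasInjectiveDimensionLT (ModuleCat.of (RetractionAlgebra A S) Y) (n + 1) := by
  induction n generalizing Y with
  | zero =>
    exact hasInjectiveDimensionLT_one_iff_injective.trans <|
      (injective_iff_retraction A S Y).trans hasInjectiveDimensionLT_one_iff_injective.symm
  | succ n ih =>
    obtain ⟨J, _, _, f, _, _, hf⟩ :=
      exists_finite_injective_embedding (A := RetractionAlgebra A S) Y
    obtain ⟨_, _⟩ := exists_restriction (A := A) (S := S) J
    have : Module.Injective A J := (injective_iff_retraction A S J).2 inferInstance
    have hexact := LinearMap.exact_map_mkQ_range f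
    have hsurj := (LinearMap.range f).mkQ_surjective
    exact (hasInjectiveDimensionLT_left_iff_of_injective (f := f.restrictScalars A)
      (g := (LinearMap.range f).mkQ.restrictScalars A) hf hexact hsurj n).trans <|
      (ih _).trans (hasInjectiveDimensionLT_left_iff_of_injective hf hexact hsurj n).symm

lemma finiteInjDim_iff_retraction :
    FiniteInjDim A Y ↔ FiniteInjDim (RetractionAlgebra A S) Y := by
  rw [finiteInjDim_iff, finiteInjDim_iff]
  exact exists_congr (hasInjectiveDimensionLT_iff_retraction A S Y)

end Comparison

section Gorenstein

variable {A : Type u} [Ring A] {S : Type u} [AddCommGroup S] [Module A S] {I : Type u}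
  [AddCommGroup I] [Module A I] {ι : S →ₗ[A] I}

lemma IsInjectiveEnvelope.isotypicComponent_eq_range [IsSimpleModule A S]
    (hι : IsInjectiveEnvelope ι) : isotypicComponent A I S = LinearMap.range ι := by
  refine le_antisymm (sSup_le fun m ⟨e⟩ x hx => ?_) ?_
  · rw [← Subtype.coe_mk x hx, ← e.symm_apply_apply ⟨x, hx⟩]
    exact hι.apply_mem_range (m.subtype ∘ₗ e.symm.toLinearMap) (e ⟨x, hx⟩)
  · rintro _ ⟨s, rfl⟩
    exact apply_mem_isotypicComponent ι s

variable [IsArtinAlgebra A] [IsLocalizable A S]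

lemma IsInjectiveEnvelope.finiteInjDim_iff [Module.Finite A I] (hι : IsInjectiveEnvelope ι)
    {Y : Type u} [AddCommGroup Y] [Module A Y] {η : I →ₗ[A] Y} (h : IsReflection A S η) :
    FiniteInjDim A S ↔ FiniteInjDim A Y := by
  have := IsLocalizable.isSimple (A := A) (S := S)
  have := hι.moduleInjective
  have hexact : Function.Exact ι η :=
    LinearMap.exact_iff.2 (h.ker_eq.trans hι.isotypicComponent_eq_range)
  exact ⟨fun hS => .of_exact_right hι.injective hexact h.surjective_of_injective hS .of_injective,
    .of_exact_left hι.injective hexact h.surjective_of_injective .of_injective⟩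

lemma isGorenstein_iff_retractionAlgebra (hS : FiniteInjDim A S) :
    IsGorenstein A ↔ IsGorenstein (RetractionAlgebra A S) := by
  have hid : FiniteInjDim A A ↔ FiniteInjDim (RetractionAlgebra A S) (RetractionAlgebra A S) :=
    ((isReflection_etaLinear A S).finiteInjDim_iff hS).trans (finiteInjDim_iff_retraction A S _)
  constructor
  · refine fun hA => isGorenstein_iff_finiteInjDim.2 ⟨hid.1 hA.1, fun J _ _ _ _ => ?_⟩
    obtain ⟨_, _⟩ := exists_restriction (A := A) (S := S) J
    have : Module.Finite A J := .trans (RetractionAlgebra A S) J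
    exact (finiteProjDim_iff_retraction A S J).1
      (hA.finiteProjDim ((finiteInjDim_iff_retraction A S J).2 .of_injective))
  · refine fun hL => isGorenstein_iff_finiteInjDim.2 ⟨hid.2 hL.1, fun J _ _ _ _ => ?_⟩
    obtain ⟨Y, _, _, _, _, _, η, h⟩ := exists_isReflection A S J
    have hY : FiniteInjDim (RetractionAlgebra A S) Y :=
      (finiteInjDim_iff_retraction A S Y).1 ((h.finiteInjDim_iff hS).1 .of_injective)
    exact h.finiteProjDim_iff.2 ((finiteProjDim_iff_retraction A S Y).2 (hL.finiteProjDim hY))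

end Gorenstein

theorem mainTheorem3 (A : Type u) [Ring A] [IsArtinAlgebra A]
    (S : Type u) [AddCommGroup S] [Module A S] [IsLocalizable A S]
    (I : Type u) [AddCommGroup I] [Module A I] [Module.Finite A I]
    (ι : S →ₗ[A] I) (hι : IsInjectiveEnvelope ι) :
    IsGorenstein A ↔
      IsGorenstein (RetractionAlgebra A S) ∧
        projectiveDimension
          ((perpToModule A S).obj ((iLambda A S).obj (FGModuleCat.of A I))) < ⊤ := by
  let Y := (iLambda A S).obj (FGModuleCat.of A I)
  have : Module.Finite (RetractionAlgebra A S) Y.obj := .of_restrictScalars_finite A _ _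
  have hidS : FiniteInjDim A S ↔ FiniteInjDim (RetractionAlgebra A S) Y.obj :=
    (hι.finiteInjDim_iff (isReflection_perpUnit (FGModuleCat.of A I))).trans
      (finiteInjDim_iff_retraction A S Y.obj)
  change IsGorenstein A ↔
    IsGorenstein (RetractionAlgebra A S) ∧ FiniteProjDim (RetractionAlgebra A S) Y.obj
  have := IsLocalizable.isSimple (A := A) (S := S)
  constructor
  · intro hA
    have hS := hA.finiteInjDim (IsLocalizable.finiteProjDim A S)
    have hL := (isGorenstein_iff_retractionAlgebra hS).1 hA
    exact ⟨hL, hL.finiteProjDim (hidS.1 hS)⟩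
  · rintro ⟨hL, hY⟩
    exact (isGorenstein_iff_retractionAlgebra (hidS.2 (hL.finiteInjDim hY))).2 hL
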